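/- Let $\mathsf U\subseteq\mathbb R^m$ be a convex set and let $\Sigma=(\mathbb R^n,\mathsf U,\mathcal U,f)$ be a smooth control system: $f:\mathbb R^n\times\mathsf U\to\mathbb R^n$ is smooth (it extends smoothly to a neighbourhood of $\mathbb R^n\times\mathsf U$, and the derivatives below are those of this extension), for every compact $Q\subset\mathbb R^n$ there is $Z>0$ with $\|f(x,u)-f(y,u)\|\le Z\|x-y\|$ for all $x,y\in Q$, $u\in\mathsf U$, and $\mathcal U$ is the set of measurable, locally essentially bounded functions from open intervals $]a,b[\,\ni 0$ to $\mathsf U$. A trajectory under $\upsilon\in\mathcal U$ is a locally absolutely continuous curve $\xi$ with $\dot\xi(t)=f(\xi(t),\upsilon(t))$ for almost all $t$. Let $G$ be a Riemannian metric on $\mathbb R^n$ (a smooth map with symmetric positive definite values $G(x)\in\mathbb R^{n\times n}$), let $\mathbf d_G(x,y)$ be the infimum of $\int_0^1\sqrt{\chi'(s)^TG(\chi(s))\chi'(s)}\,ds$ over piecewise smooth paths $\chi:[0,1]\to\mathbb R^n$ from $x$ to $y$, and assume that $(\mathbb R^n,\mathbf d_G)$ is a complete metric space. Put $\langle X,Y\rangle_M=X^TMY$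 and $$F(x,u)=\Big(\frac{\partial f}{\partial x}\Big)^TG(x)+G(x)\frac{\partial f}{\partial x}+\frac{\partial G}{\partial x}f(x,u).$$ (i) *States and inputs.* Suppose that $G$ is a contraction metric with respect to states and inputs: there are $\widehat\lambda>0$ and $\alpha\ge 0$ such that for all $x,X\in\mathbb R^n$, $u\in\mathsf U$, $Y\in\mathbb R^m$ $$\langle X,X\rangle_F+2\Big\langle\frac{\partial f}{\partial u}Y,X\Big\rangle_G\le-\widehat\lambda\langle X,X\rangle_G+\alpha\langle X,X\rangle_G^{1/2}\,\|Y\|.$$ Then $\Sigma$ is $\delta_\exists$-ISS: it is forward complete (for every $x$ and every input on an interval $]a,\infty[$ there is a trajectory from $x$ on some interval $]a',\infty[$, and every trajectory under that input extends to one on an interval of this form), and there are a metric $\mathbf d$ on $\mathbb R^n$, a class $\mathcal{KL}$ function $\beta$ (each $\beta(\cdot,s)$ being of class $\mathcal K_\infty$) and a class $\mathcal K_\infty$ function $\gamma$ such that all trajectories $\xi,\xi'$ under inputs $\upsilon,\upsilon'$ satisfy, for all $t\ge0$ at which both are defined, $$\mathbf d(\xi(t),\xi'(t))\le\beta(\mathbf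 d(\xi(0),\xi'(0)),t)+\gamma(\|\upsilon-\upsilon'\|_\infty).$$ Moreover, for any such $\widehat\lambda,\alpha$, $$\mathbf d_G(\xi(t),\xi'(t))\le e^{-\widehat\lambda t/2}\,\mathbf d_G(\xi(0),\xi'(0))+\frac{\alpha}{\widehat\lambda}\|\upsilon-\upsilon'\|_\infty .$$ Here $\|\upsilon-\upsilon'\|_\infty$ is the essential supremum over the nonnegative times at which both inputs are defined, and the estimates are void when it is infinite. (ii) *States only.* Suppose that $G$ is a contraction metric with respect to states: there is $\widehat\lambda>0$ with $\langle X,X\rangle_F\le-\widehat\lambda\langle X,X\rangle_G$ for all $x,X\in\mathbb R^n$, $u\in\mathsf U$. Then for any such $\widehat\lambda$ and all trajectories $\xi,\xi'$ under the same input, $\mathbf d_G(\xi(t),\xi'(t))\le e^{-\widehat\lambda t/2}\,\mathbf d_G(\xi(0),\xi'(0))$ for all $t\ge 0$ at which both are defined. If moreover, for each $x$, $f(x,\cdot)$ is bounded on bounded subsets of $\mathsf U$ (which is automatic when $\mathsf U$ is closed), then $\Sigma$ is $\delta_\exists$-GAS: it is forward complete, and there are a metric $\mathbf d$ on $\mathbb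 R^n$ and a class $\mathcal{KL}$ function $\beta$ with $\mathbf d(\xi(t),\xi'(t))\le\beta(\mathbf d(\xi(0),\xi'(0)),t)$ for all trajectories $\xi,\xi'$ under the same input and all $t\ge0$ at which both are defined. -/

import Mathlib

open MeasureTheory Filter Topology Set
open scoped NNReal ENNReal ContDiff Matrix

noncomputable section

namespace IncrementalStability

/-- Euclidean space `ℝᵏ` with the Euclidean norm. -/
abbrev E (k : ℕ) : Type := EuclideanSpace ℝ (Fin k)

/-! ### Control systems and trajectories -/

/-- The data `(ℝⁿ, U, f)` of a control system. The input class is `IsInput U`, see below.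
Only the values of `f x u` with `u ∈ U` (and, for derivatives in `u`, their germ at such points)
are used. -/
structure ControlSystem (n m : ℕ) where
  /-- the input set -/
  U : Set (E m)
  /-- the right-hand side -/
  f : E n → E m → E n
  continuousOn : ContinuousOn (fun p : E n × E m => f p.1 p.2) (univ ×ˢ U)
  lipschitz : ∀ Q : Set (E n), IsCompact Q → ∃ Z : ℝ, 0 < Z ∧
    ∀ x ∈ Q, ∀ y ∈ Q, ∀ u ∈ U, ‖f x u - f y u‖ ≤ Z * ‖x - y‖

/-- `I` is an open interval `]a, b[` with `-∞ ≤ a < 0 < b ≤ ∞`. -/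
def IsTimeInterval (I : Set ℝ) : Prop :=
  IsOpen I ∧ I.OrdConnected ∧ (0 : ℝ) ∈ I

/-- `υ`, restricted to the time interval `I`, is an admissible input: a measurable, locally
essentially bounded function `I → U`. -/
structure IsInput {m : ℕ} (U : Set (E m)) (I : Set ℝ) (υ : ℝ → E m) : Prop where
  interval : IsTimeInterval I
  measurable : Measurable (I.domRestrict υ)
  mem : ∀ t ∈ I, υ t ∈ U
  locallyBounded : ∀ τ : ℝ, 0 < τ → ∃ C : ℝ, ∀ᵐ t : ℝ, t ∈ I → |t| ≤ τ → ‖υ t‖ ≤ C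

/-- `‖υ - υ'‖_∞`, the essential supremum over the nonnegative times at which both inputs
(defined on `I` and `I'`) are defined. -/
def inputDist {m : ℕ} (I I' : Set ℝ) (υ υ' : ℝ → E m) : ℝ≥0∞ :=
  eLpNorm (fun t => υ t - υ' t) ⊤ (volume.restrict (I ∩ I' ∩ Ici 0))

namespace ControlSystem

variable {n m : ℕ}

/-- The system is smooth: `f` is smooth (i.e. extends smoothly, through the values of the
function `S.f`) around every point of `ℝⁿ × U`. -/
def IsSmooth (S : ControlSystem n m) : Prop :=
  ∀ x : E n, ∀ u ∈ S.U, ContDiffAt ℝ ∞ (fun p : E n × E m => S.f p.1 p.2) (x, u)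

/-- `ξ : I → ℝⁿ` is a trajectory under the input `υ : I → U`: a locally absolutely continuous
curve with `ξ'(t) = f(ξ(t), υ(t))` for almost all `t ∈ I`. -/
structure IsTrajectory (S : ControlSystem n m) (I : Set ℝ) (υ : ℝ → E m) (ξ : ℝ → E n) :
    Prop where
  input : IsInput S.U I υ
  absCont : ∀ s ∈ I, ∀ t ∈ I, AbsolutelyContinuousOnInterval ξ s t
  deriv_eq : ∀ᵐ t : ℝ, t ∈ I → HasDerivAt ξ (S.f (ξ t) (υ t)) t

/-- Forward completeness: for every input `υ` on an interval `]a, ∞[`, there is from every initial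
state a trajectory on some interval `]a', ∞[`, and every trajectory under `υ` on a smaller interval
extends to a trajectory on an interval of the form `]a', ∞[`. -/
def ForwardComplete (S : ControlSystem n m) : Prop :=
  ∀ (I : Set ℝ) (υ : ℝ → E m), IsInput S.U I υ → ¬ BddAbove I →
    (∀ x : E n, ∃ (J : Set ℝ) (ξ : ℝ → E n),
      J ⊆ I ∧ ¬ BddAbove J ∧ S.IsTrajectory J υ ξ ∧ ξ 0 = x) ∧
    (∀ (J : Set ℝ) (ξ : ℝ → E n), J ⊆ I → S.IsTrajectory J υ ξ →
      ∃ (J' : Set ℝ) (ξ' : ℝ → E n),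
        J ⊆ J' ∧ J' ⊆ I ∧ ¬ BddAbove J' ∧ S.IsTrajectory J' υ ξ' ∧ EqOn ξ ξ' J)

end ControlSystem

/-! ### Metrics and comparison functions -/

/-- `d` is a metric on `X`. -/
structure IsMetric {X : Type*} (d : X → X → ℝ≥0) : Prop where
  eq_zero_iff : ∀ x y, d x y = 0 ↔ x = y
  symm : ∀ x y, d x y = d y x
  triangle : ∀ x y z, d x z ≤ d x y + d y z

/-- Every Cauchy sequence for `d` converges for `d`. -/
def IsCompleteDist {X : Type*} (d : X → X → ℝ≥0) : Prop :=
  ∀ x : ℕ → X, (∀ ε : ℝ≥0, 0 < ε → ∃ N : ℕ, ∀ p ≥ N, ∀ q ≥ N, d (x p) (x q) < ε) →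
    ∃ y : X, Tendsto (fun k => d (x k) y) atTop (𝓝 0)

/-- Class `𝒦_∞`. -/
structure IsClassKInf (γ : ℝ≥0 → ℝ≥0) : Prop where
  continuous : Continuous γ
  strictMono : StrictMono γ
  map_zero : γ 0 = 0
  tendsto : Tendsto γ atTop atTop

/-- Class `𝒦ℒ`. -/
structure IsClassKL (β : ℝ≥0 → ℝ≥0 → ℝ≥0) : Prop where
  continuous : Continuous (fun p : ℝ≥0 × ℝ≥0 => β p.1 p.2)
  classKInf : ∀ s, IsClassKInf (fun r => β r s)
  strictAnti : ∀ r, r ≠ 0 → StrictAnti (β r)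
  tendsto : ∀ r, r ≠ 0 → Tendsto (β r) atTop (𝓝 0)

/-! ### Incremental stability -/

namespace ControlSystem

variable {n m : ℕ}

/-- Incremental global asymptotic stability with respect to some metric (`δ_∃`-GAS). -/
def IsDeltaGAS (S : ControlSystem n m) : Prop :=
  S.ForwardComplete ∧
  ∃ (d : E n → E n → ℝ≥0) (β : ℝ≥0 → ℝ≥0 → ℝ≥0), IsMetric d ∧ IsClassKL β ∧
    ∀ (I I' : Set ℝ) (υ : ℝ → E m) (ξ ξ' : ℝ → E n),
      S.IsTrajectory I υ ξ → S.IsTrajectory I' υ ξ' →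
      ∀ t : ℝ≥0, (t : ℝ) ∈ I → (t : ℝ) ∈ I' → d (ξ t) (ξ' t) ≤ β (d (ξ 0) (ξ' 0)) t

/-- Incremental input-to-state stability with respect to some metric (`δ_∃`-ISS). The estimate
is void when `‖υ - υ'‖_∞ = ∞`. -/
def IsDeltaISS (S : ControlSystem n m) : Prop :=
  S.ForwardComplete ∧
  ∃ (d : E n → E n → ℝ≥0) (β : ℝ≥0 → ℝ≥0 → ℝ≥0) (γ : ℝ≥0 → ℝ≥0),
    IsMetric d ∧ IsClassKL β ∧ IsClassKInf γ ∧
    ∀ (I I' : Set ℝ) (υ υ' : ℝ → E m) (ξ ξ' : ℝ → E n),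
      S.IsTrajectory I υ ξ → S.IsTrajectory I' υ' ξ' → inputDist I I' υ υ' ≠ ⊤ →
      ∀ t : ℝ≥0, (t : ℝ) ∈ I → (t : ℝ) ∈ I' →
        d (ξ t) (ξ' t) ≤ β (d (ξ 0) (ξ' 0)) t + γ (inputDist I I' υ υ').toNNReal

end ControlSystem

/-! ### Riemannian metrics on `ℝⁿ` and their distance -/

/-- `⟨X, Y⟩_M = Xᵀ M Y`. -/
def form {k : ℕ} (M : Matrix (Fin k) (Fin k) ℝ) (X Y : Fin k → ℝ) : ℝ :=
  X ⬝ᵥ (M *ᵥ Y)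

/-- `G` is a Riemannian metric on `ℝⁿ`: smooth, with symmetric positive definite values. -/
structure IsRiemannianMetric {n : ℕ} (G : E n → Matrix (Fin n) (Fin n) ℝ) : Prop where
  smooth : ∀ i j, ContDiff ℝ ∞ (fun x => G x i j)
  posDef : ∀ x, (G x).PosDef

/-- `χ : [0,1] → ℝⁿ` is a piecewise smooth path from `x` to `y`: continuous, and smooth off
finitely many points. -/
def IsPath {n : ℕ} (x y : E n) (χ : ℝ → E n) : Prop :=
  ContinuousOn χ (Icc 0 1) ∧ χ 0 = x ∧ χ 1 = y ∧
    ∃ P : Finset ℝ, ContDiffOn ℝ ∞ χ (Ioo 0 1 \ (P : Set ℝ))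

/-- The length `∫₀¹ (χ'ᵀ G(χ) χ')^{1/2} ds`. -/
def length {n : ℕ} (G : E n → Matrix (Fin n) (Fin n) ℝ) (χ : ℝ → E n) : ℝ≥0∞ :=
  ∫⁻ s in Ioo (0 : ℝ) 1, ENNReal.ofReal (Real.sqrt (form (G (χ s)) (deriv χ s).ofLp (deriv χ s).ofLp))

/-- The Riemannian distance `d_G(x, y)`, the infimum of the lengths of piecewise smooth paths. -/
def riemannianDist {n : ℕ} (G : E n → Matrix (Fin n) (Fin n) ℝ) (x y : E n) : ℝ≥0 :=
  (⨅ (χ : ℝ → E n) (_ : IsPath x y χ), length G χ).toNNReal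

/-! ### Contraction metrics -/

section Contraction

variable {n m : ℕ}

/-- The Jacobian matrix of `g` at `x`. -/
def jacobian {k l : ℕ} (g : E k → E l) (x : E k) : Matrix (Fin l) (Fin k) ℝ :=
  Matrix.of fun i j => fderiv ℝ g x (EuclideanSpace.single j 1) i

/-- The derivative `(∂G/∂x) v` of the matrix function `G` at `x` in the direction `v`. -/
def metricDeriv (G : E n → Matrix (Fin n) (Fin n) ℝ) (x v : E n) : Matrix (Fin n) (Fin n) ℝ :=
  Matrix.of fun i j => fderiv ℝ (fun y => G y i j) x v

/-- `∂f/∂x (x, u)`. -/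
def dfdx (S : ControlSystem n m) (x : E n) (u : E m) : Matrix (Fin n) (Fin n) ℝ :=
  jacobian (fun y => S.f y u) x

/-- `∂f/∂u (x, u)`. -/
def dfdu (S : ControlSystem n m) (x : E n) (u : E m) : Matrix (Fin n) (Fin m) ℝ :=
  jacobian (fun v => S.f x v) u

/-- `F(x, u) = (∂f/∂x)ᵀ G + G ∂f/∂x + (∂G/∂x) f(x, u)`. -/
def contractionMatrix (S : ControlSystem n m) (G : E n → Matrix (Fin n) (Fin n) ℝ)
    (x : E n) (u : E m) : Matrix (Fin n) (Fin n) ℝ :=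
  (dfdx S x u)ᵀ * G x + G x * dfdx S x u + metricDeriv G x (S.f x u)

/-- The contraction inequality with respect to states, with rate `lam`. -/
def ContractsStates (S : ControlSystem n m) (G : E n → Matrix (Fin n) (Fin n) ℝ)
    (lam : ℝ) : Prop :=
  ∀ u ∈ S.U, ∀ (x : E n) (X : Fin n → ℝ),
    form (contractionMatrix S G x u) X X ≤ -lam * form (G x) X X

/-- The contraction inequality with respect to states and inputs, with constants `lam`, `α`. -/
def ContractsStatesInputs (S : ControlSystem n m) (G : E n → Matrix (Fin n) (Fin n) ℝ)
    (lam α : ℝ) : Prop :=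
  ∀ u ∈ S.U, ∀ (x : E n) (X : Fin n → ℝ) (Y : Fin m → ℝ),
    form (contractionMatrix S G x u) X X + 2 * form (G x) (dfdu S x u *ᵥ Y) X ≤
      -lam * form (G x) X X + α * Real.sqrt (form (G x) X X) * Real.sqrt (form 1 Y Y)

/-- `G` is a contraction metric with respect to states. -/
def IsContractionMetricStates (S : ControlSystem n m)
    (G : E n → Matrix (Fin n) (Fin n) ℝ) : Prop :=
  ∃ lam : ℝ, 0 < lam ∧ ContractsStates S G lam

/-- `G` is a contraction metric with respect to states and inputs. -/
def IsContractionMetricStatesInputs (S : ControlSystem n m)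
    (G : E n → Matrix (Fin n) (Fin n) ℝ) : Prop :=
  ∃ lam α : ℝ, 0 < lam ∧ 0 ≤ α ∧ ContractsStatesInputs S G lam α

end Contraction

end IncrementalStability

end

/-!
The proof bounds the growth of `D(t) = d_G(ξ(t), ξ'(t))` by a differential inequality which holds
for almost every `t`, so that no differentiability of the flow in its initial state is needed (the
inputs are only measurable in time).

Fix a time `t` at which both curves are differentiable, let `u = υ(t)` and `g = f(·, u)`, and
write the velocity of `ξ'` as `g(ξ'(t)) + e`, where `e` is the defect of `ξ'` with respect to the
input `u`. Take a path `χ` from `ξ(t)` to `ξ'(t)` of almost minimal length, and move it by one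
Euler step of the *fixed* smooth field `g`, to `χ + h g(χ)`. The derivative at `h = 0` of the
squared norm of the image of a tangent vector `X` is `⟨X, X⟩_F ≤ -λ ⟨X, X⟩_G`, so the step
shortens the path by the factor `1 - λ'h/2`, for every `λ' < λ` and all small `h`. This holds
uniformly in the path, since all almost minimal paths stay in one compact set: `d_G` is complete,
hence its bounded sets are relatively compact by the Hopf-Rinow-Cohn-Vossen theorem
(`isCompact_closedBall_of_approx_between`). The end points of the moved path differ from
`ξ(t + h)` and `ξ'(t + h)` by `o(h)` and by at most `h |e|_G + o(h)`. Hence `D' ≤ -(λ/2) D + |e|_G`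
almost everywhere (`IsRiemannianMetric.deriv_dist_le`). As `D` is absolutely continuous,
Gronwall's inequality (`le_of_ae_deriv_le`) applies; the result is `dist_le_of_defect`, which is
used three times.

* For a common input, `e = 0`.
* For two inputs, `e = f(ξ'(t), υ'(t)) - f(ξ'(t), υ(t))`. Letting `X` tend to `0` in the
  contraction inequality leaves `2 ⟨(∂f/∂u) Y, X⟩_G ≤ α |X|_G ‖Y‖`. Integrating this over the
  segment between the two inputs, which lies in the convex set `U`, gives
  `|e|_G ≤ (α/2) ‖υ(t) - υ'(t)‖` (`ContractsStatesInputs.gnorm_sub_le`).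
* For the constant curve `ξ' = x`, `e = -f(x, υ(t))` is bounded on bounded time intervals. So the
  trajectories from `x` stay bounded on such intervals, and Picard iteration
  (`exists_local_solution`) continues them by steps of a uniform size. This gives forward
  completeness; the continuations agree with each other by the contraction estimate itself.
-/

noncomputable section

namespace IncrementalStability

variable {n m : ℕ} {G : E n → Matrix (Fin n) (Fin n) ℝ}

/-! ### The norm of a metric at a point -/

/-- The norm `⟨v, v⟩_M^{1/2}` of `v`, with the junk value `0` if the form is negative at `v`. -/
def gnorm (M : Matrix (Fin n) (Fin n) ℝ) (v : E n) : ℝ := √(form M v.ofLp v.ofLp)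

lemma gnorm_nonneg (M : Matrix (Fin n) (Fin n) ℝ) (v : E n) : 0 ≤ gnorm M v := Real.sqrt_nonneg _

lemma form_smul_smul (M : Matrix (Fin n) (Fin n) ℝ) (c : ℝ) (v w : Fin n → ℝ) :
    form M (c • v) (c • w) = c ^ 2 * form M v w := by
  simp only [form, Matrix.mulVec_smul, smul_dotProduct, dotProduct_smul, smul_eq_mul]
  ring

lemma gnorm_smul (M : Matrix (Fin n) (Fin n) ℝ) (c : ℝ) (v : E n) :
    gnorm M (c • v) = |c| * gnorm M v := by
  simp only [gnorm, WithLp.ofLp_smul, form_smul_smul]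
  rw [Real.sqrt_mul (sq_nonneg c), Real.sqrt_sq_eq_abs]

namespace IsRiemannianMetric

variable (hG : IsRiemannianMetric G)
include hG

lemma continuous_form : Continuous fun p : E n × E n => form (G p.1) p.2.ofLp p.2.ofLp := by
  have h (i j) : Continuous fun p : E n × E n => G p.1 i j :=
    (hG.smooth i j).continuous.comp continuous_fst
  have h' (i) : Continuous fun p : E n × E n => p.2.ofLp i := by fun_prop
  simp only [form, dotProduct, Matrix.mulVec]
  exact continuous_finsetSum _ fun i _ => (h' i).mul <|
    continuous_finsetSum _ fun j _ => (h i j).mul (h' j)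

lemma continuous_gnorm : Continuous fun p : E n × E n => gnorm (G p.1) p.2 :=
  hG.continuous_form.sqrt

lemma form_nonneg (x : E n) (v : Fin n → ℝ) : 0 ≤ form (G x) v v := by
  simpa [form] using (hG.posDef x).posSemidef.dotProduct_mulVec_nonneg v

lemma form_pos (x : E n) {v : Fin n → ℝ} (hv : v ≠ 0) : 0 < form (G x) v v := by
  simpa [form] using (hG.posDef x).dotProduct_mulVec_pos hv

lemma gnorm_sq (x v : E n) : gnorm (G x) v ^ 2 = form (G x) v.ofLp v.ofLp :=
  Real.sq_sqrt (hG.form_nonneg x _)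

lemma gnorm_pos (x : E n) {v : E n} (hv : v ≠ 0) : 0 < gnorm (G x) v :=
  Real.sqrt_pos.2 (hG.form_pos x fun h => hv (by ext i; simpa using congrFun h i))

lemma exists_gnorm_le {K : Set (E n)} (hK : IsCompact K) :
    ∃ C : ℝ, 0 < C ∧ ∀ x ∈ K, ∀ v, gnorm (G x) v ≤ C * ‖v‖ := by
  obtain ⟨C, hC⟩ := (hK.prod (isCompact_sphere (0 : E n) 1)).exists_bound_of_continuousOn
    hG.continuous_gnorm.continuousOn
  refine ⟨max C 1, by positivity, fun x hx v => ?_⟩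
  by_cases hv : v = 0
  · simp [hv, gnorm, form]
  have hv' : 0 < ‖v‖ := norm_pos_iff.2 hv
  have := hC (x, ‖v‖⁻¹ • v) ⟨hx, by simp [norm_smul, hv'.ne']⟩
  rw [Real.norm_of_nonneg (gnorm_nonneg _ _), gnorm_smul, abs_of_pos (by positivity)] at this
  rw [inv_mul_le_iff₀ hv'] at this
  calc gnorm (G x) v ≤ ‖v‖ * C := this
    _ ≤ max C 1 * ‖v‖ := by rw [mul_comm]; gcongr; exact le_max_left _ _

lemma exists_le_gnorm {K : Set (E n)} (hK : IsCompact K) :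
    ∃ c : ℝ, 0 < c ∧ ∀ x ∈ K, ∀ v, c * ‖v‖ ≤ gnorm (G x) v := by
  obtain ⟨c, hc0, hc⟩ := (hK.prod (isCompact_sphere (0 : E n) 1)).exists_forall_le'
    (a := 0) hG.continuous_gnorm.continuousOn
    (fun p hp => hG.gnorm_pos p.1 (v := p.2) (by
      rintro h; have := hp.2; simp [h] at this))
  refine ⟨c, hc0, fun x hx v => ?_⟩
  by_cases hv : v = 0
  · simp [hv, gnorm, form]
  have hv' : 0 < ‖v‖ := norm_pos_iff.2 hv
  have := hc (x, ‖v‖⁻¹ • v) ⟨hx, by simp [norm_smul, hv'.ne']⟩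
  rw [gnorm_smul, abs_of_pos (by positivity), le_inv_mul_iff₀ hv'] at this
  linarith

end IsRiemannianMetric

/-! ### Piecewise smooth curves and their lengths -/

/-- `χ` is continuous on `[a, b]`, and smooth around all but finitely many points of `]a, b[`. -/
structure PiecewiseSmooth (a b : ℝ) (χ : ℝ → E n) : Prop where
  continuousOn : ContinuousOn χ (Icc a b)
  smooth : ∃ P : Finset ℝ, ∀ s ∈ Ioo a b, s ∉ P → ContDiffAt ℝ ∞ χ s

lemma isPath_iff {x y : E n} {χ : ℝ → E n} :
    IsPath x y χ ↔ PiecewiseSmooth 0 1 χ ∧ χ 0 = x ∧ χ 1 = y := by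
  have key (P : Finset ℝ) : ContDiffOn ℝ ∞ χ (Ioo 0 1 \ (P : Set ℝ)) ↔
      ∀ s ∈ Ioo (0 : ℝ) 1, s ∉ P → ContDiffAt ℝ ∞ χ s := by
    have ho : IsOpen (Ioo (0 : ℝ) 1 \ (P : Set ℝ)) := isOpen_Ioo.sdiff P.finite_toSet.isClosed
    exact ⟨fun h s hs hP => (h s ⟨hs, hP⟩).contDiffAt (ho.mem_nhds ⟨hs, hP⟩),
      fun h s hs => (h s hs.1 hs.2).contDiffWithinAt⟩
  constructor
  · rintro ⟨h1, h2, h3, P, hP⟩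
    exact ⟨⟨h1, P, (key P).1 hP⟩, h2, h3⟩
  · rintro ⟨⟨h1, P, hP⟩, h2, h3⟩
    exact ⟨h1, h2, h3, P, (key P).2 hP⟩

/-- The speed of the curve `χ` for the metric `G`, at the parameter `s`. -/
def speed (G : E n → Matrix (Fin n) (Fin n) ℝ) (χ : ℝ → E n) (s : ℝ) : ℝ≥0∞ :=
  ENNReal.ofReal (gnorm (G (χ s)) (deriv χ s))

/-- The distance `d_G` with values in `[0, ∞]`, before its conversion to a real number. -/
def infLength (G : E n → Matrix (Fin n) (Fin n) ℝ) (x y : E n) : ℝ≥0∞ :=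
  ⨅ (χ : ℝ → E n) (_ : IsPath x y χ), length G χ

lemma length_eq (χ : ℝ → E n) : length G χ = ∫⁻ s in Ioo (0 : ℝ) 1, speed G χ s := rfl

lemma speed_congr {χ χ' : ℝ → E n} {s : ℝ} (h : χ =ᶠ[𝓝 s] χ') : speed G χ s = speed G χ' s := by
  simp only [speed, h.deriv_eq, h.eq_of_nhds]

lemma deriv_comp_affine (χ : ℝ → E n) (c k s : ℝ) :
    deriv (fun s => χ (c * s + k)) s = c • deriv χ (c * s + k) := by
  have := deriv_comp_mul_left c (fun s => χ (s + k)) s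
  simp only [deriv_comp_add_const] at this
  exact this

lemma speed_comp_affine (χ : ℝ → E n) (c k s : ℝ) :
    speed G (fun s => χ (c * s + k)) s = ENNReal.ofReal |c| * speed G χ (c * s + k) := by
  simp only [speed, deriv_comp_affine, gnorm_smul, ENNReal.ofReal_mul (abs_nonneg c)]

/-- Lengths are invariant under affine changes of the parameter. -/
lemma lintegral_speed_comp_affine (χ : ℝ → E n) {c : ℝ} (hc : c ≠ 0) (k : ℝ) {A : Set ℝ}
    (hA : MeasurableSet A) :
    ∫⁻ s in A, speed G (fun s => χ (c * s + k)) s =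
      ∫⁻ s in (fun s => c * s + k) '' A, speed G χ s := by
  rw [lintegral_image_eq_lintegral_abs_deriv_mul (f' := fun _ => c) hA]
  · simp only [speed_comp_affine]
  · intro x _
    simpa using (((hasDerivAt_id x).const_mul c).add_const k).hasDerivWithinAt
  · intro x _ y _ h
    simpa [hc] using h

lemma PiecewiseSmooth.comp_affine {χ : ℝ → E n} {a b a' b' c k : ℝ} (h : PiecewiseSmooth a b χ)
    (hc : c ≠ 0) (hI : MapsTo (fun s => c * s + k) (Icc a' b') (Icc a b))
    (hI' : MapsTo (fun s => c * s + k) (Ioo a' b') (Ioo a b)) :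
    PiecewiseSmooth a' b' (fun s => χ (c * s + k)) := by
  obtain ⟨h1, P, hP⟩ := h
  refine ⟨h1.comp (by fun_prop) hI, P.image (fun s => (s - k) / c), fun s hs hsP => ?_⟩
  have : ContDiffAt ℝ ∞ χ (c * s + k) := hP _ (hI' hs) fun hmem => hsP
    (Finset.mem_image.2 ⟨_, hmem, by field_simp; ring⟩)
  exact this.comp s (f := fun s : ℝ => c * s + k) (by fun_prop)

lemma PiecewiseSmooth.mono {χ : ℝ → E n} {a b a' b' : ℝ} (h : PiecewiseSmooth a b χ)
    (ha : a ≤ a') (hb : b' ≤ b) : PiecewiseSmooth a' b' χ := by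
  obtain ⟨h1, P, hP⟩ := h
  exact ⟨h1.mono (Icc_subset_Icc ha hb), P, fun s hs => hP s (Ioo_subset_Ioo ha hb hs)⟩

lemma PiecewiseSmooth.comp_smooth {χ : ℝ → E n} {a b : ℝ} (h : PiecewiseSmooth a b χ)
    {φ : E n → E n} (hφ : ContDiff ℝ ∞ φ) : PiecewiseSmooth a b (fun s => φ (χ s)) := by
  obtain ⟨h1, P, hP⟩ := h
  exact ⟨hφ.continuous.comp_continuousOn h1, P,
    fun s hs hsP => hφ.contDiffAt.comp s (hP s hs hsP)⟩

lemma PiecewiseSmooth.of_contDiff {χ : ℝ → E n} (h : ContDiff ℝ ∞ χ) (a b : ℝ) :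
    PiecewiseSmooth a b χ :=
  ⟨h.continuous.continuousOn, ∅, fun _ _ _ => h.contDiffAt⟩

/-- A curve parametrized by an arbitrary interval bounds the distance of its end points. -/
lemma infLength_le {χ : ℝ → E n} {a b : ℝ} (hab : a < b) (h : PiecewiseSmooth a b χ) :
    infLength G (χ a) (χ b) ≤ ∫⁻ s in Ioo a b, speed G χ s := by
  have hc : b - a ≠ 0 := (sub_pos.2 hab).ne'
  have hp : IsPath (χ a) (χ b) (fun s => χ ((b - a) * s + a)) := by
    refine isPath_iff.2 ⟨h.comp_affine hc ?_ ?_, by simp, by simp⟩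
    · rintro s ⟨h0, h1⟩
      constructor <;> nlinarith
    · rintro s ⟨h0, h1⟩
      constructor <;> nlinarith
  refine (iInf₂_le _ hp).trans ?_
  rw [length_eq, lintegral_speed_comp_affine χ hc a measurableSet_Ioo]
  apply lintegral_mono_set
  rintro _ ⟨s, ⟨h0, h1⟩, rfl⟩
  constructor <;> nlinarith

lemma infLength_le_symm {χ : ℝ → E n} {a b : ℝ} (hab : a < b) (h : PiecewiseSmooth a b χ) :
    infLength G (χ b) (χ a) ≤ ∫⁻ s in Ioo a b, speed G χ s := by
  have hp : PiecewiseSmooth (-b) (-a) (fun s => χ (-1 * s + 0)) := by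
    refine h.comp_affine (by norm_num) ?_ ?_
    · rintro s ⟨h0, h1⟩
      constructor <;> linarith
    · rintro s ⟨h0, h1⟩
      constructor <;> linarith
  have := infLength_le (G := G) (neg_lt_neg hab) hp
  simp only [neg_mul, one_mul, neg_neg, add_zero] at this
  refine this.trans ?_
  have h2 := lintegral_speed_comp_affine (G := G) χ (c := -1) (by norm_num) 0
    (measurableSet_Ioo (a := -b) (b := -a))
  simp only [neg_mul, one_mul, add_zero] at h2
  rw [h2]
  apply lintegral_mono_set
  rintro _ ⟨s, ⟨h0, h1⟩, rfl⟩
  constructor <;> linarith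

lemma infLength_comm (x y : E n) : infLength G x y = infLength G y x := by
  have key (x y : E n) : infLength G x y ≤ infLength G y x := by
    refine le_iInf₂ fun χ hχ => ?_
    obtain ⟨h, rfl, rfl⟩ := isPath_iff.1 hχ
    exact infLength_le_symm one_pos h
  exact le_antisymm (key x y) (key y x)

/-- Paths are concatenated on `[0, 2]`, with one more exceptional point at the junction `1`. -/
lemma infLength_triangle (x y z : E n) :
    infLength G x z ≤ infLength G x y + infLength G y z := by
  suffices ∀ χ, IsPath x y χ → ∀ ψ, IsPath y z ψ →
      infLength G x z ≤ length G χ + length G ψ by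
    conv_rhs => unfold infLength
    simp only [ENNReal.iInf_add, ENNReal.add_iInf]
    exact le_iInf₂ fun χ hχ => le_iInf₂ fun ψ hψ => this ψ hψ χ hχ
  intro χ hχ ψ hψ
  obtain ⟨⟨hc1, P, hP⟩, h10, h11⟩ := isPath_iff.1 hχ
  obtain ⟨⟨hc2, Q, hQ⟩, h20, h21⟩ := isPath_iff.1 hψ
  set ρ : ℝ → E n := fun s => if s ≤ 1 then χ s else ψ (1 * s + (-1)) with hρ
  have e1 (s : ℝ) (hs : s < 1) : ρ =ᶠ[𝓝 s] χ := by
    filter_upwards [Iio_mem_nhds hs] with t ht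
    simp [hρ, (mem_Iio.1 ht).le]
  have e2 (s : ℝ) (hs : 1 < s) : ρ =ᶠ[𝓝 s] fun s => ψ (1 * s + (-1)) := by
    filter_upwards [Ioi_mem_nhds hs] with t ht
    simp [hρ, not_le.2 (mem_Ioi.1 ht)]
  have hpw : PiecewiseSmooth 0 2 ρ := by
    constructor
    · have : ContinuousOn ρ (Icc 0 1 ∪ Icc 1 2) := by
        refine ContinuousOn.union_of_isClosed ?_ ?_ isClosed_Icc isClosed_Icc
        · exact hc1.congr fun s hs => by simp [hρ, hs.2]
        · have : ContinuousOn (fun s => ψ (1 * s + (-1))) (Icc 1 2) :=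
            hc2.comp (by fun_prop) fun s hs => ⟨by linarith [hs.1], by linarith [hs.2]⟩
          refine this.congr fun s hs => ?_
          rcases hs.1.eq_or_lt with rfl | h
          · simp [hρ, h20, h11]
          · simp [hρ, not_le.2 h]
      rwa [Icc_union_Icc_eq_Icc zero_le_one one_le_two] at this
    · refine ⟨insert 1 (P ∪ Q.image (· + 1)), fun s hs hsP => ?_⟩
      simp only [Finset.mem_insert, Finset.mem_union, Finset.mem_image, not_or, not_exists] at hsP
      rcases lt_or_gt_of_ne hsP.1 with h | h
      · exact (hP s ⟨hs.1, h⟩ hsP.2.1).congr_of_eventuallyEq (e1 s h)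
      · refine ContDiffAt.congr_of_eventuallyEq ?_ (e2 s h)
        have : ContDiffAt ℝ ∞ ψ (1 * s + (-1)) := hQ _ ⟨by linarith, by linarith [hs.2]⟩
          fun hmem => hsP.2.2 _ ⟨hmem, by ring⟩
        exact this.comp s (f := fun s : ℝ => 1 * s + (-1)) (by fun_prop)
  have := infLength_le (G := G) two_pos hpw
  have h0 : ρ 0 = x := by simp [hρ, h10]
  have h2 : ρ 2 = z := by simp [hρ, ← h21]; norm_num
  rw [h0, h2] at this
  refine this.trans ?_
  have hsplit : Ioo (0 : ℝ) 2 ⊆ (Ioo 0 1 ∪ Ioo 1 2) ∪ {1} := by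
    intro s hs
    rcases lt_trichotomy s 1 with h | h | h
    · exact Or.inl (Or.inl ⟨hs.1, h⟩)
    · exact Or.inr h
    · exact Or.inl (Or.inr ⟨h, hs.2⟩)
  calc ∫⁻ s in Ioo 0 2, speed G ρ s
      ≤ ∫⁻ s in (Ioo 0 1 ∪ Ioo 1 2) ∪ {1}, speed G ρ s := lintegral_mono_set hsplit
    _ ≤ (∫⁻ s in Ioo 0 1 ∪ Ioo 1 2, speed G ρ s) + ∫⁻ s in {1}, speed G ρ s :=
        lintegral_union_le _ _ _
    _ = ∫⁻ s in Ioo 0 1 ∪ Ioo 1 2, speed G ρ s := by simp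
    _ ≤ (∫⁻ s in Ioo 0 1, speed G ρ s) + ∫⁻ s in Ioo 1 2, speed G ρ s := lintegral_union_le _ _ _
    _ = length G χ + length G ψ := by
        congr 1
        · rw [length_eq]
          exact setLIntegral_congr_fun measurableSet_Ioo fun s hs => speed_congr (e1 s hs.2)
        · rw [length_eq, setLIntegral_congr_fun measurableSet_Ioo
            fun s hs => speed_congr (e2 s hs.1), lintegral_speed_comp_affine ψ one_ne_zero (-1)
            measurableSet_Ioo]
          simp
          norm_num

/-! ### Complete, locally compact length spaces are proper -/

/-- The Hopf-Rinow-Cohn-Vossen theorem: in a complete, locally compact metric space in which points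
are joined by chains of almost minimal length, closed balls are compact. The compact radii form an
interval containing `0`, which is closed by completeness and open by local compactness. -/
theorem isCompact_closedBall_of_approx_between {M : Type*} [MetricSpace M] [CompleteSpace M]
    [LocallyCompactSpace M]
    (h : ∀ (x y : M) (r ε : ℝ), 0 ≤ r → r ≤ dist x y → 0 < ε →
      ∃ z, dist x z ≤ r ∧ dist z y ≤ dist x y - r + ε) (x : M) (R : ℝ) :
    IsCompact (Metric.closedBall x R) := by
  by_contra hR
  set S : Set ℝ := {r | IsCompact (Metric.closedBall x r)} with hS
  have hmono {r r' : ℝ} (hr : r ∈ S) (h : r' ≤ r) : r' ∈ S :=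
    IsCompact.of_isClosed_subset hr Metric.isClosed_closedBall
      (Metric.closedBall_subset_closedBall h)
  have hbdd : BddAbove S := ⟨R, fun r hr => by
    by_contra! hlt
    exact hR (hmono hr hlt.le)⟩
  have h0 : (0 : ℝ) ∈ S := by
    change IsCompact (Metric.closedBall x 0)
    rw [Metric.closedBall_zero]
    exact isCompact_singleton
  set R₀ := sSup S with hR₀
  have hR₀0 : 0 ≤ R₀ := le_csSup hbdd h0
  have hlt {r : ℝ} (hr : r < R₀) : r ∈ S := by
    obtain ⟨r', hr', hrr'⟩ := exists_lt_of_lt_csSup ⟨0, h0⟩ hr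
    exact hmono hr' hrr'.le
  have hmem : IsCompact (Metric.closedBall x R₀) := by
    rcases hR₀0.eq_or_lt with h' | hpos
    · rw [← h']
      exact h0
    refine isCompact_iff_totallyBounded_isComplete.2
      ⟨?_, Metric.isClosed_closedBall.isComplete⟩
    refine Metric.totallyBounded_iff.2 fun ε hε => ?_
    set r := max 0 (R₀ - ε / 3)
    have hr : r < R₀ := max_lt hpos (by linarith)
    have hr' : R₀ - r ≤ ε / 3 := by linarith [le_max_right 0 (R₀ - ε / 3)]
    obtain ⟨t, ht, hcov⟩ := Metric.totallyBounded_iff.1 (IsCompact.totallyBounded (hlt hr))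
      (ε / 3) (by positivity)
    refine ⟨t, ht, fun y hy => ?_⟩
    have hy' : dist x y ≤ R₀ := by rw [dist_comm]; exact hy
    obtain ⟨z, hz, hzy⟩ : ∃ z, dist x z ≤ r ∧ dist z y ≤ ε / 3 + ε / 4 := by
      rcases le_total (dist x y) r with hle | hle
      · exact ⟨y, hle, by rw [dist_self]; positivity⟩
      · obtain ⟨z, hz, hzy⟩ := h x y r (ε / 4) (le_max_left _ _) hle (by positivity)
        exact ⟨z, hz, by linarith⟩
    have hzB : z ∈ Metric.closedBall x r := by rwa [Metric.mem_closedBall, dist_comm]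
    obtain ⟨p, hp, hzp⟩ := mem_iUnion₂.1 (hcov hzB)
    refine mem_iUnion₂.2 ⟨p, hp, ?_⟩
    rw [Metric.mem_ball] at hzp ⊢
    have := dist_triangle y z p
    rw [dist_comm y z] at this
    linarith
  obtain ⟨K', hK', hsub⟩ := exists_compact_superset hmem
  obtain ⟨δ, hδ, hth⟩ := hmem.exists_thickening_subset_open isOpen_interior hsub
  have : R₀ + δ / 2 ∈ S := by
    refine hK'.of_isClosed_subset Metric.isClosed_closedBall fun y hy => ?_
    refine interior_subset (hth ?_)
    rw [Metric.mem_closedBall, dist_comm] at hy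
    rcases le_total (dist x y) R₀ with hle | hle
    · exact Metric.self_subset_thickening hδ _ (by rwa [Metric.mem_closedBall, dist_comm])
    · obtain ⟨z, hz, hzy⟩ := h x y R₀ (δ / 4) hR₀0 hle (by positivity)
      refine Metric.mem_thickening_iff.2 ⟨z, by rwa [Metric.mem_closedBall, dist_comm], ?_⟩
      rw [dist_comm]
      linarith
  have := le_csSup hbdd this
  linarith

/-! ### Comparison of the Riemannian and the Euclidean distance -/

lemma infLength_le_of_segment {x y : E n} {L : ℝ}
    (h : ∀ s ∈ Icc (0 : ℝ) 1, gnorm (G (x + s • (y - x))) (y - x) ≤ L) :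
    infLength G x y ≤ ENNReal.ofReal L := by
  set χ : ℝ → E n := fun s => x + s • (y - x) with hχ
  have hd (s : ℝ) : HasDerivAt χ (y - x) s := by
    simpa [hχ] using ((hasDerivAt_id s).smul_const (y - x)).const_add x
  have := infLength_le (G := G) one_pos
    (PiecewiseSmooth.of_contDiff (χ := χ) (by simp only [hχ]; fun_prop) 0 1)
  simp only [hχ, zero_smul, add_zero, one_smul, add_sub_cancel] at this
  refine this.trans ?_
  calc ∫⁻ s in Ioo 0 1, speed G χ s ≤ ∫⁻ s in Ioo (0 : ℝ) 1, ENNReal.ofReal L := by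
        refine setLIntegral_mono' measurableSet_Ioo fun s hs => ?_
        rw [speed, (hd s).deriv]
        exact ENNReal.ofReal_le_ofReal (h s ⟨hs.1.le, hs.2.le⟩)
    _ = ENNReal.ofReal L := by simp

lemma infLength_self (x : E n) : infLength G x x = 0 := by
  have := infLength_le_of_segment (G := G) (x := x) (y := x) (L := 0)
    (by simp [gnorm, form])
  simpa using this

lemma infLength_le' {χ : ℝ → E n} {a b : ℝ} (hab : a ≤ b) (h : PiecewiseSmooth a b χ) :
    infLength G (χ a) (χ b) ≤ ∫⁻ s in Ioo a b, speed G χ s := by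
  rcases hab.eq_or_lt with rfl | hab
  · simp [infLength_self]
  · exact infLength_le hab h

/-- The derivative may fail to be integrable near the exceptional points; then the length is
infinite. -/
lemma PiecewiseSmooth.enorm_sub_le {χ : ℝ → E n} {a b : ℝ} (hab : a ≤ b)
    (h : PiecewiseSmooth a b χ) : ‖χ b - χ a‖ₑ ≤ ∫⁻ s in Ioo a b, ‖deriv χ s‖ₑ := by
  obtain ⟨hc, P, hP⟩ := h
  by_cases hfin : ∫⁻ s in Ioo a b, ‖deriv χ s‖ₑ = ⊤
  · simp [hfin]
  have hint : IntervalIntegrable (deriv χ) volume a b := by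
    rw [intervalIntegrable_iff_integrableOn_Ioo_of_le hab]
    exact ⟨(measurable_deriv χ).aestronglyMeasurable, lt_top_iff_ne_top.2 hfin⟩
  rw [← integral_eq_of_hasDerivAt_off_countable_of_le χ (deriv χ) hab P.countable_toSet hc
    (fun s hs => ((hP s hs.1 hs.2).differentiableAt (by simp)).hasDerivAt) hint,
    intervalIntegral.integral_of_le hab, integral_Ioc_eq_integral_Ioo]
  exact enorm_integral_le_lintegral_enorm _

/-- If `G` is bounded below by `c²` on the ball of radius `r` around `x`, then `d_G(x, ·)` is
bounded below by `c` times the Euclidean distance, up to the distance `r`: a path either stays in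
the ball, or already its part up to its first exit from the ball is long. -/
lemma le_infLength {x y : E n} {c r : ℝ} (hc : 0 < c) (hr : 0 ≤ r)
    (h : ∀ z ∈ Metric.closedBall x r, ∀ v, c * ‖v‖ ≤ gnorm (G z) v) :
    ENNReal.ofReal (c * min r ‖y - x‖) ≤ infLength G x y := by
  refine le_iInf₂ fun χ hχ => ?_
  obtain ⟨hpw, h0, h1⟩ := isPath_iff.1 hχ
  have hcont : ContinuousOn (fun s => ‖χ s - x‖) (Icc 0 1) :=
    (hpw.continuousOn.sub continuousOn_const).norm
  set l := min r ‖y - x‖ with hl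
  have hl0 : 0 ≤ l := le_min hr (norm_nonneg _)
  -- the first time at which the path has the distance `l` from `x`
  have hKc : IsCompact (Icc (0 : ℝ) 1 ∩ (fun s => ‖χ s - x‖) ⁻¹' {l}) :=
    isCompact_Icc.of_isClosed_subset
      (hcont.preimage_isClosed_of_isClosed isClosed_Icc isClosed_singleton) inter_subset_left
  have hKne : (Icc (0 : ℝ) 1 ∩ (fun s => ‖χ s - x‖) ⁻¹' {l}).Nonempty := by
    obtain ⟨s, hs, hsl⟩ := intermediate_value_Icc zero_le_one hcont
      (show l ∈ Icc _ _ by simp [h0, h1, hl, hr])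
    exact ⟨s, hs, hsl⟩
  obtain ⟨τ, ⟨hτ, hτl⟩, hmin⟩ := hKc.exists_isLeast hKne
  have hτl : ‖χ τ - x‖ = l := hτl
  have hin (s : ℝ) (hs : s ∈ Ioo 0 τ) : χ s ∈ Metric.closedBall x r := by
    rw [mem_closedBall_iff_norm]
    by_contra! hgt
    obtain ⟨s', hs', hsl⟩ := intermediate_value_Icc hs.1.le
      (hcont.mono (Icc_subset_Icc le_rfl (hs.2.le.trans hτ.2)))
      (show l ∈ Icc _ _ from ⟨by simp [h0, hl0], (min_le_left _ _).trans hgt.le⟩)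
    have := hmin ⟨⟨hs'.1, hs'.2.trans (hs.2.le.trans hτ.2)⟩, hsl⟩
    linarith [hs'.2, hs.2]
  have hE := (hpw.mono le_rfl hτ.2).enorm_sub_le hτ.1
  rw [h0, ← ofReal_norm, hτl] at hE
  calc ENNReal.ofReal (c * l) = ENNReal.ofReal c * ENNReal.ofReal l := ENNReal.ofReal_mul hc.le
    _ ≤ ENNReal.ofReal c * ∫⁻ s in Ioo 0 τ, ‖deriv χ s‖ₑ := by gcongr
    _ = ∫⁻ s in Ioo 0 τ, ENNReal.ofReal c * ‖deriv χ s‖ₑ :=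
        (lintegral_const_mul _ (measurable_deriv χ).enorm).symm
    _ ≤ ∫⁻ s in Ioo 0 τ, speed G χ s := by
        refine setLIntegral_mono' measurableSet_Ioo fun s hs => ?_
        rw [← ofReal_norm, ← ENNReal.ofReal_mul hc.le]
        exact ENNReal.ofReal_le_ofReal (h _ (hin s hs) _)
    _ ≤ length G χ := by
        rw [length_eq]
        exact lintegral_mono_set (Ioo_subset_Ioo le_rfl hτ.2)

namespace IsRiemannianMetric

variable (hG : IsRiemannianMetric G)
include hG

lemma infLength_ne_top (x y : E n) : infLength G x y ≠ ⊤ := by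
  have hK : IsCompact ((fun s : ℝ => x + s • (y - x)) '' Icc 0 1) :=
    isCompact_Icc.image (by fun_prop)
  obtain ⟨C, -, hC⟩ := hG.exists_gnorm_le hK
  exact ((infLength_le_of_segment fun s hs => hC _ ⟨s, hs, rfl⟩ (y - x)).trans_lt
    ENNReal.ofReal_lt_top).ne

lemma coe_riemannianDist (x y : E n) : (riemannianDist G x y : ℝ≥0∞) = infLength G x y :=
  ENNReal.coe_toNNReal (hG.infLength_ne_top x y)

lemma riemannianDist_le_iff {x y : E n} {L : ℝ} (hL : 0 ≤ L) :
    (riemannianDist G x y : ℝ) ≤ L ↔ infLength G x y ≤ ENNReal.ofReal L := by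
  rw [← hG.coe_riemannianDist, ENNReal.le_ofReal_iff_toReal_le (by simp) hL]
  simp

lemma riemannianDist_triangle (x y z : E n) :
    riemannianDist G x z ≤ riemannianDist G x y + riemannianDist G y z := by
  have := infLength_triangle (G := G) x y z
  simp only [← hG.coe_riemannianDist] at this
  exact_mod_cast this

lemma riemannianDist_le_of_segment {x y : E n} {L : ℝ}
    (h : ∀ s ∈ Icc (0 : ℝ) 1, gnorm (G (x + s • (y - x))) (y - x) ≤ L) :
    (riemannianDist G x y : ℝ) ≤ L := by
  have h0 : 0 ≤ L := (gnorm_nonneg _ _).trans (h 0 ⟨le_rfl, zero_le_one⟩)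
  exact (hG.riemannianDist_le_iff h0).2 (infLength_le_of_segment h)

lemma exists_riemannianDist_le (R : ℝ) : ∃ C : ℝ, 0 < C ∧
    ∀ x ∈ Metric.closedBall (0 : E n) R, ∀ y ∈ Metric.closedBall (0 : E n) R,
      (riemannianDist G x y : ℝ) ≤ C * ‖x - y‖ := by
  obtain ⟨C, hC, h⟩ := hG.exists_gnorm_le (isCompact_closedBall (0 : E n) R)
  refine ⟨C, hC, fun x hx y hy => hG.riemannianDist_le_of_segment fun s hs => ?_⟩
  rw [norm_sub_rev]
  exact h _ ((convex_closedBall _ _).add_smul_sub_mem hx hy hs) _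

lemma exists_le_riemannianDist (x : E n) : ∃ c : ℝ, 0 < c ∧
    ∀ r ∈ Icc (0 : ℝ) 1, ∀ y, c * min r ‖y - x‖ ≤ riemannianDist G x y := by
  obtain ⟨c, hc, h⟩ := hG.exists_le_gnorm (isCompact_closedBall x 1)
  refine ⟨c, hc, fun r hr y => ?_⟩
  have := le_infLength (y := y) hc hr.1
    fun z hz => h z (Metric.closedBall_subset_closedBall hr.2 hz)
  rw [← hG.coe_riemannianDist, ENNReal.ofReal_le_iff_le_toReal (by simp)] at this
  simpa using this

lemma isMetric : IsMetric (riemannianDist G) where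
  eq_zero_iff x y := by
    refine ⟨fun h => ?_, ?_⟩
    swap
    · rintro rfl
      change (infLength G x x).toNNReal = 0
      simp [infLength_self]
    obtain ⟨c, hc, hle⟩ := hG.exists_le_riemannianDist x
    have := hle 1 (by simp) y
    rw [h, NNReal.coe_zero] at this
    by_contra hne
    have h2 : 0 < ‖y - x‖ := norm_pos_iff.2 (sub_ne_zero.2 (Ne.symm hne))
    have : 0 < c * min 1 ‖y - x‖ := by positivity
    linarith
  symm x y := congrArg ENNReal.toNNReal (infLength_comm x y)
  triangle := hG.riemannianDist_triangle

end IsRiemannianMetric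

/-! ### Bounded sets for a complete Riemannian metric -/

/-- The space `ℝⁿ` with the metric `d_G`: a type synonym, which keeps this metric apart from the
Euclidean one. -/
def RSpace (_ : IsRiemannianMetric G) : Type := E n

instance (hG : IsRiemannianMetric G) : MetricSpace (RSpace hG) where
  dist x y := riemannianDist (n := n) G x y
  dist_self x := by simpa using (hG.isMetric.eq_zero_iff x x).2 rfl
  dist_comm x y := congrArg _ (hG.isMetric.symm x y)
  dist_triangle x y z := by exact_mod_cast hG.isMetric.triangle x y z
  eq_of_dist_eq_zero {x y} h := (hG.isMetric.eq_zero_iff x y).1 (by exact_mod_cast h)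

namespace IsRiemannianMetric

variable (hG : IsRiemannianMetric G)

/-- The identity, as a homeomorphism from the Euclidean topology to that of `d_G`. -/
def toRSpace : E n ≃ₜ RSpace hG where
  toEquiv := Equiv.refl _
  continuous_toFun := by
    refine continuous_iff_continuousAt.2 fun x => ?_
    obtain ⟨C, -, hC⟩ := hG.exists_riemannianDist_le (‖x‖ + 1)
    refine tendsto_iff_dist_tendsto_zero.2 ?_
    have hlim : Tendsto (fun y => C * ‖y - x‖) (𝓝 x) (𝓝 0) := by
      have : Continuous fun y => C * ‖y - x‖ := by fun_prop
      simpa using this.tendsto x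
    refine squeeze_zero' (.of_forall fun _ => dist_nonneg) ?_ hlim
    filter_upwards [Metric.ball_mem_nhds x one_pos] with y hy
    refine hC y ?_ x ?_
    · rw [mem_ball_iff_norm] at hy
      rw [mem_closedBall_zero_iff]
      have := norm_le_norm_add_norm_sub' y x
      linarith
    · simp
  continuous_invFun := by
    refine Metric.continuous_iff.2 fun (x : E n) ε hε => ?_
    obtain ⟨c, hc, hle⟩ := hG.exists_le_riemannianDist x
    refine ⟨c * min 1 ε, by positivity, fun (y : E n) hy => ?_⟩
    have h1 := hle 1 (by simp) y
    have h2 : (riemannianDist (n := n) G x y : ℝ) < c * min 1 ε := by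
      rw [hG.isMetric.symm]; exact hy
    have h3 := lt_of_mul_lt_mul_left (h1.trans_lt h2) hc.le
    have h4 : ‖y - x‖ < ε := by
      rcases min_lt_iff.1 h3 with h | h
      · exact absurd (h.trans_le (min_le_left _ _)) (lt_irrefl _)
      · exact h.trans_le (min_le_right _ _)
    change dist (α := E n) y x < ε
    rwa [dist_eq_norm]

include hG in
lemma continuous_riemannianDist (x : E n) : Continuous fun y => (riemannianDist G x y : ℝ) :=
  (continuous_const (y := hG.toRSpace x)).dist hG.toRSpace.continuous

lemma completeSpace (hcomplete : IsCompleteDist (riemannianDist G)) :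
    CompleteSpace (RSpace hG) := by
  refine Metric.complete_of_cauchySeq_tendsto fun u hu => ?_
  obtain ⟨y, hy⟩ := hcomplete u fun ε hε => by
    obtain ⟨N, hN⟩ := Metric.cauchySeq_iff.1 hu ε hε
    exact ⟨N, fun p hp q hq => by exact_mod_cast hN p hp q hq⟩
  refine ⟨y, tendsto_iff_dist_tendsto_zero.2 ?_⟩
  exact NNReal.tendsto_coe.2 hy

include hG in
/-- Every path passes through points at all smaller distances from its starting point. -/
lemma exists_between {x y : E n} {r ε : ℝ} (hr : 0 ≤ r) (hrd : r ≤ riemannianDist G x y)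
    (hε : 0 < ε) : ∃ z, (riemannianDist G x z : ℝ) ≤ r ∧
      (riemannianDist G z y : ℝ) ≤ riemannianDist G x y - r + ε := by
  have hlt : infLength G x y < ENNReal.ofReal (riemannianDist G x y + ε) := by
    rw [← hG.coe_riemannianDist, ENNReal.lt_ofReal_iff_toReal_lt (by simp)]
    simpa using hε
  simp only [infLength, iInf_lt_iff] at hlt
  obtain ⟨χ, hχ, hχl⟩ := hlt
  obtain ⟨hpw, rfl, rfl⟩ := isPath_iff.1 hχ
  obtain ⟨s, hs, hsr⟩ := intermediate_value_Icc zero_le_one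
    ((hG.continuous_riemannianDist (χ 0)).comp_continuousOn hpw.continuousOn)
    (show r ∈ Icc _ _ by simpa [(hG.isMetric.eq_zero_iff _ _).2 rfl] using ⟨hr, hrd⟩)
  have hsr : (riemannianDist G (χ 0) (χ s) : ℝ) = r := hsr
  refine ⟨χ s, hsr.le, ?_⟩
  have h1 := infLength_le' (G := G) hs.1 (hpw.mono le_rfl hs.2)
  have h2 := infLength_le' (G := G) hs.2 (hpw.mono hs.1 le_rfl)
  have hd : Disjoint (Ioo 0 s) (Ioo s 1) :=
    Set.disjoint_left.2 fun t ht ht' => lt_asymm ht.2 ht'.1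
  have hsum : infLength G (χ 0) (χ s) + infLength G (χ s) (χ 1) ≤
      ENNReal.ofReal (riemannianDist G (χ 0) (χ 1) + ε) := by
    refine (add_le_add h1 h2).trans (le_trans ?_ hχl.le)
    rw [← lintegral_union measurableSet_Ioo hd, length_eq]
    exact lintegral_mono_set
      (union_subset (Ioo_subset_Ioo le_rfl hs.2) (Ioo_subset_Ioo hs.1 le_rfl))
  rw [← hG.coe_riemannianDist, ← hG.coe_riemannianDist, ← ENNReal.coe_add,
    ENNReal.le_ofReal_iff_toReal_le (by simp) (by positivity)] at hsum
  simp only [ENNReal.coe_toReal, NNReal.coe_add] at hsum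
  linarith

include hG in
/-- If `d_G` is complete, then its bounded sets are bounded for the Euclidean norm (Hopf-Rinow). -/
theorem exists_norm_le (hcomplete : IsCompleteDist (riemannianDist G)) (x : E n) (R : ℝ) :
    ∃ r : ℝ, ∀ y, (riemannianDist G x y : ℝ) ≤ R → ‖y‖ ≤ r := by
  have := hG.completeSpace hcomplete
  have : LocallyCompactSpace (RSpace hG) :=
    hG.toRSpace.symm.isOpenEmbedding.locallyCompactSpace
  have hK := isCompact_closedBall_of_approx_between (M := RSpace hG)
    (fun x y r ε hr hrd hε => hG.exists_between (n := n) hr hrd hε) (hG.toRSpace x) R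
  obtain ⟨r, hr⟩ := (hK.image hG.toRSpace.symm.continuous).isBounded.exists_norm_le
  refine ⟨r, fun y hy => hr y ⟨hG.toRSpace y, ?_, rfl⟩⟩
  rw [Metric.mem_closedBall, dist_comm]
  exact hy

end IsRiemannianMetric

/-! ### The contraction inequality along the flow of a fixed vector field -/

lemma jacobian_mulVec {k l : ℕ} (g : E k → E l) (x v : E k) :
    jacobian g x *ᵥ v.ofLp = (fderiv ℝ g x v).ofLp := by
  have hv : v = ∑ j, v j • EuclideanSpace.single j (1 : ℝ) := by
    simpa using ((EuclideanSpace.basisFun (Fin k) ℝ).sum_repr v).symm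
  ext i
  conv_rhs => rw [hv, map_sum]
  simp [jacobian, Matrix.mulVec, dotProduct, mul_comm]

lemma hasDerivAt_form {M : ℝ → Matrix (Fin n) (Fin n) ℝ} {M' : Matrix (Fin n) (Fin n) ℝ}
    {a b : ℝ → E n} {a' b' : E n} {t : ℝ} (hM : ∀ i j, HasDerivAt (fun s => M s i j) (M' i j) t)
    (ha : HasDerivAt a a' t) (hb : HasDerivAt b b' t) :
    HasDerivAt (fun s => form (M s) (a s).ofLp (b s).ofLp)
      (form M' (a t).ofLp (b t).ofLp + form (M t) a'.ofLp (b t).ofLp +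
        form (M t) (a t).ofLp b'.ofLp) t := by
  have hcoord {a : ℝ → E n} {a' : E n} (ha : HasDerivAt a a' t) (i : Fin n) :
      HasDerivAt (fun s => (a s).ofLp i) (a'.ofLp i) t :=
    (EuclideanSpace.proj (𝕜 := ℝ) i).hasFDerivAt.comp_hasDerivAt t ha
  have := HasDerivAt.fun_sum (u := Finset.univ) fun i _ => (hcoord ha i).fun_mul
    (HasDerivAt.fun_sum (u := Finset.univ) fun j _ => (hM i j).fun_mul (hcoord hb j))
  refine this.congr_deriv ?_
  simp only [form, dotProduct, Matrix.mulVec, mul_add, Finset.sum_add_distrib]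
  ring

lemma continuous_form_comp {X : Type*} [TopologicalSpace X] {M : X → Matrix (Fin n) (Fin n) ℝ}
    {a b : X → E n} (hM : ∀ i j, Continuous fun p => M p i j) (ha : Continuous a)
    (hb : Continuous b) : Continuous fun p => form (M p) (a p).ofLp (b p).ofLp := by
  have h' {a : X → E n} (ha : Continuous a) (i) : Continuous fun p => (a p).ofLp i :=
    (EuclideanSpace.proj (𝕜 := ℝ) i).continuous.comp ha
  simp only [form, dotProduct, Matrix.mulVec]
  exact continuous_finsetSum _ fun i _ => (h' ha i).mul <|
    continuous_finsetSum _ fun j _ => (hM i j).mul (h' hb j)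

/-- `G` contracts along the vector field `g` at the rate `lam`. -/
def ContractsField (G : E n → Matrix (Fin n) (Fin n) ℝ) (g : E n → E n) (lam : ℝ) : Prop :=
  ∀ x (X : Fin n → ℝ), form ((jacobian g x)ᵀ * G x + G x * jacobian g x + metricDeriv G x (g x)) X X
    ≤ -lam * form (G x) X X

/-- The derivative at time `h` of `⟨w, w⟩_G` along the Euler step `x + h g(x)`, where
`w = v + h Dg(x) v` is the image of the tangent vector `v`. -/
def stepDeriv (G : E n → Matrix (Fin n) (Fin n) ℝ) (g : E n → E n) (h : ℝ) (x v : E n) : ℝ :=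
  form (metricDeriv G (x + h • g x) (g x)) (v + h • fderiv ℝ g x v).ofLp
      (v + h • fderiv ℝ g x v).ofLp +
    form (G (x + h • g x)) (fderiv ℝ g x v).ofLp (v + h • fderiv ℝ g x v).ofLp +
    form (G (x + h • g x)) (v + h • fderiv ℝ g x v).ofLp (fderiv ℝ g x v).ofLp

lemma form_transpose_mul (A M : Matrix (Fin n) (Fin n) ℝ) (v w : Fin n → ℝ) :
    form (Aᵀ * M) v w = form M (A *ᵥ v) w := by
  simp only [form, ← Matrix.mulVec_mulVec]
  rw [Matrix.dotProduct_mulVec, Matrix.vecMul_transpose]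

lemma ContractsField.stepDeriv_zero_le {g : E n → E n} {lam : ℝ} (h : ContractsField G g lam)
    (x v : E n) : stepDeriv G g 0 x v ≤ -lam * form (G x) v.ofLp v.ofLp := by
  refine le_trans (le_of_eq ?_) (h x v.ofLp)
  have h1 : form (G x * jacobian g x) v.ofLp v.ofLp =
      form (G x) v.ofLp (jacobian g x *ᵥ v.ofLp) := by
    simp only [form, ← Matrix.mulVec_mulVec]
  have hadd (A B C : Matrix (Fin n) (Fin n) ℝ) (v : Fin n → ℝ) :
      form (A + B + C) v v = form A v v + form B v v + form C v v := by
    simp only [form, Matrix.add_mulVec, dotProduct_add]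
  rw [hadd, form_transpose_mul, h1, jacobian_mulVec]
  simp only [stepDeriv, zero_smul, add_zero]
  ring

namespace IsRiemannianMetric

variable (hG : IsRiemannianMetric G)
include hG

lemma hasDerivAt_step (g : E n → E n) (x v : E n) (h : ℝ) :
    HasDerivAt (fun h => form (G (x + h • g x)) (v + h • fderiv ℝ g x v).ofLp
      (v + h • fderiv ℝ g x v).ofLp) (stepDeriv G g h x v) h := by
  have hline (a b : E n) : HasDerivAt (fun h : ℝ => a + h • b) b h := by
    simpa using ((hasDerivAt_id h).smul_const b).const_add a
  refine hasDerivAt_form (M := fun h => G (x + h • g x)) (fun i j => ?_) (hline _ _) (hline _ _)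
  exact (((hG.smooth i j).differentiable (by simp)) _).hasFDerivAt.comp_hasDerivAt h (hline x (g x))

lemma continuous_stepDeriv {g : E n → E n} (hg : ContDiff ℝ ∞ g) :
    Continuous fun p : ℝ × E n × E n => stepDeriv G g p.1 p.2.1 p.2.2 := by
  have hgc : Continuous g := hg.continuous
  have hD : Continuous (fderiv ℝ g) := hg.continuous_fderiv (by simp)
  have h1 : Continuous fun p : ℝ × E n × E n => p.2.1 + p.1 • g p.2.1 := by fun_prop
  have h2 : Continuous fun p : ℝ × E n × E n => fderiv ℝ g p.2.1 p.2.2 :=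
    (hD.comp (by fun_prop)).clm_apply (by fun_prop)
  have h3 : Continuous fun p : ℝ × E n × E n => p.2.2 + p.1 • fderiv ℝ g p.2.1 p.2.2 :=
    (by fun_prop : Continuous fun p : ℝ × E n × E n => p.2.2).add (continuous_fst.smul h2)
  have h4 (i j) : Continuous fun p : ℝ × E n × E n => G (p.2.1 + p.1 • g p.2.1) i j :=
    (hG.smooth i j).continuous.comp h1
  have h5 (i j) : Continuous fun p : ℝ × E n × E n =>
      metricDeriv G (p.2.1 + p.1 • g p.2.1) (g p.2.1) i j :=
    (((hG.smooth i j).continuous_fderiv (by simp)).comp h1).clm_apply (by fun_prop)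
  exact ((continuous_form_comp h5 h3 h3).add (continuous_form_comp h4 h2 h3)).add
    (continuous_form_comp h4 h3 h2)

/-- Short Euler steps along a contracting field contract tangent vectors, uniformly over compact
sets, at any rate below the rate of the field. -/
lemma exists_step_gnorm_le {g : E n → E n} (hg : ContDiff ℝ ∞ g) {lam lam' : ℝ}
    (hc : ContractsField G g lam) (h0 : 0 < lam') (hlam : lam' < lam) {K : Set (E n)}
    (hK : IsCompact K) :
    ∃ δ > 0, ∀ h ∈ Ico 0 δ, 0 ≤ 1 - lam' / 2 * h ∧ ∀ x ∈ K, ∀ v,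
      gnorm (G (x + h • g x)) (v + h • fderiv ℝ g x v) ≤ (1 - lam' / 2 * h) * gnorm (G x) v := by
  set T := K ×ˢ Metric.sphere (0 : E n) 1
  set N : Set (ℝ × E n × E n) :=
    {p | stepDeriv G g p.1 p.2.1 p.2.2 < -lam' * form (G p.2.1) p.2.2.ofLp p.2.2.ofLp}
  have hN : IsOpen N := isOpen_lt (hG.continuous_stepDeriv hg)
    (continuous_const.mul (hG.continuous_form.comp continuous_snd))
  have hsub : ({0} : Set ℝ) ×ˢ T ⊆ N := by
    rintro ⟨h, x, v⟩ ⟨hh, hx, hv⟩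
    obtain rfl : h = 0 := hh
    have hpos : 0 < form (G x) v.ofLp v.ofLp := hG.form_pos x fun hv0 => by
      have : v = 0 := by ext i; simpa using congrFun hv0 i
      simp [this] at hv
    refine (hc.stepDeriv_zero_le x v).trans_lt ?_
    exact mul_lt_mul_of_pos_right (neg_lt_neg hlam) hpos
  obtain ⟨u, w, hu, -, h0u, hTw, huw⟩ :=
    generalized_tube_lemma isCompact_singleton (hK.prod (isCompact_sphere (0 : E n) 1)) hN hsub
  obtain ⟨δ, hδ, hδu⟩ := Metric.isOpen_iff.1 hu 0 (h0u rfl)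
  refine ⟨min δ (1 / lam'), by positivity, fun h hh => ?_⟩
  have hδh : h < δ := hh.2.trans_le (min_le_left _ _)
  have hlh : lam' * h < 1 := by
    have := hh.2.trans_le (min_le_right _ _)
    rwa [lt_div_iff₀ h0, mul_comm] at this
  have hnn : 0 ≤ 1 - lam' / 2 * h := by nlinarith [hh.1]
  refine ⟨hnn, fun x hx v => ?_⟩
  by_cases hv : v = 0
  · simp [hv, gnorm, form]
  have hv' : 0 < ‖v‖ := norm_pos_iff.2 hv
  -- the estimate for a unit vector
  have key (e : E n) (he : ‖e‖ = 1) : gnorm (G (x + h • g x)) (e + h • fderiv ℝ g x e) ≤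
      (1 - lam' / 2 * h) * gnorm (G x) e := by
    have hmv := (convex_Icc (0 : ℝ) h).image_sub_le_mul_sub_of_deriv_le
      (f := fun h => form (G (x + h • g x)) (e + h • fderiv ℝ g x e).ofLp
        (e + h • fderiv ℝ g x e).ofLp)
      (fun s _ => (hG.hasDerivAt_step g x e s).continuousAt.continuousWithinAt)
      (fun s _ => (hG.hasDerivAt_step g x e s).differentiableAt.differentiableWithinAt)
      (C := -lam' * form (G x) e.ofLp e.ofLp) (fun s hs => by
        rw [interior_Icc] at hs
        rw [(hG.hasDerivAt_step g x e s).deriv]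
        have : (s, x, e) ∈ N := huw ⟨hδu (by
          rw [Metric.mem_ball, dist_zero_right, Real.norm_of_nonneg hs.1.le]
          linarith [hs.2]), hTw ⟨hx, by simpa using he⟩⟩
        exact le_of_lt this) 0 ⟨le_rfl, hh.1⟩ h ⟨hh.1, le_rfl⟩ hh.1
    simp only [zero_smul, add_zero, sub_zero] at hmv
    rw [← hG.gnorm_sq, ← hG.gnorm_sq] at hmv
    refine (sq_le_sq₀ (gnorm_nonneg _ _) (mul_nonneg hnn (gnorm_nonneg _ _))).1 ?_
    nlinarith [sq_nonneg (lam' / 2 * h * gnorm (G x) e)]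
  have := key (‖v‖⁻¹ • v) (by simp [norm_smul, hv'.ne'])
  have hlin : ‖v‖⁻¹ • v + h • fderiv ℝ g x (‖v‖⁻¹ • v) = ‖v‖⁻¹ • (v + h • fderiv ℝ g x v) := by
    rw [map_smul, smul_add, smul_comm]
  rw [hlin, gnorm_smul, gnorm_smul, mul_left_comm] at this
  exact le_of_mul_le_mul_left this (by positivity)

/-- Short Euler steps along a contracting field contract the distance of two points. The paths of
almost minimal length between the points stay in a compact set, on which tangent vectors are
contracted uniformly. -/
lemma exists_step_dist_le (hcomplete : IsCompleteDist (riemannianDist G)) {g : E n → E n}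
    (hg : ContDiff ℝ ∞ g) {lam lam' : ℝ} (hc : ContractsField G g lam) (h0 : 0 < lam')
    (hlam : lam' < lam) (x y : E n) :
    ∃ δ > 0, ∀ h ∈ Ico 0 δ, (riemannianDist G (x + h • g x) (y + h • g y) : ℝ) ≤
      (1 - lam' / 2 * h) * riemannianDist G x y := by
  obtain ⟨r, hr⟩ := hG.exists_norm_le hcomplete x (riemannianDist G x y + 1)
  obtain ⟨δ, hδ, hstep⟩ := hG.exists_step_gnorm_le hg hc h0 hlam (isCompact_closedBall (0 : E n) r)
  refine ⟨δ, hδ, fun h hh => ?_⟩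
  obtain ⟨hnn, hstep⟩ := hstep h hh
  have key (ε : ℝ) (hε : 0 < ε) (hε1 : ε ≤ 1) :
      (riemannianDist G (x + h • g x) (y + h • g y) : ℝ) ≤
        (1 - lam' / 2 * h) * (riemannianDist G x y + ε) := by
    have hlt : infLength G x y < ENNReal.ofReal (riemannianDist G x y + ε) := by
      rw [← hG.coe_riemannianDist, ENNReal.lt_ofReal_iff_toReal_lt (by simp)]
      simpa using hε
    simp only [infLength, iInf_lt_iff] at hlt
    obtain ⟨χ, hχ, hχl⟩ := hlt
    obtain ⟨hpw, hx0, hy1⟩ := isPath_iff.1 hχ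
    have hK (s : ℝ) (hs : s ∈ Ioo 0 1) : χ s ∈ Metric.closedBall (0 : E n) r := by
      rw [mem_closedBall_zero_iff]
      refine hr _ ((hG.riemannianDist_le_iff (by positivity)).2 ?_)
      rw [← hx0]
      refine (infLength_le' hs.1.le (hpw.mono le_rfl hs.2.le)).trans ?_
      refine (lintegral_mono_set (Ioo_subset_Ioo le_rfl hs.2.le)).trans ?_
      rw [← length_eq, hx0]
      exact hχl.le.trans (ENNReal.ofReal_le_ofReal (by linarith))
    have hφ : ContDiff ℝ ∞ fun z => z + h • g z := contDiff_id.add (hg.const_smul h)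
    rw [hG.riemannianDist_le_iff (by positivity)]
    have hle := infLength_le (G := G) one_pos (hpw.comp_smooth hφ)
    simp only [hx0, hy1] at hle
    refine hle.trans ?_
    rw [ENNReal.ofReal_mul hnn]
    refine le_trans ?_ (mul_le_mul_right hχl.le _)
    rw [length_eq, ← lintegral_const_mul' _ _ ENNReal.ofReal_ne_top]
    refine lintegral_mono_ae ((ae_restrict_iff' measurableSet_Ioo).2 ?_)
    obtain ⟨-, P, hP⟩ := hpw
    filter_upwards [P.countable_toSet.ae_notMem volume] with s hsP hs
    have hd : HasDerivAt χ (deriv χ s) s :=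
      ((hP s hs hsP).differentiableAt (by simp)).hasDerivAt
    have hd2 : HasDerivAt (fun s => χ s + h • g (χ s))
        (deriv χ s + h • fderiv ℝ g (χ s) (deriv χ s)) s :=
      hd.add ((((hg.differentiable (by simp)) _).hasFDerivAt.comp_hasDerivAt s hd).const_smul h)
    rw [speed, speed, hd2.deriv, ← ENNReal.ofReal_mul hnn]
    exact ENNReal.ofReal_le_ofReal (hstep _ (hK s hs) _)
  have hlim : Tendsto (fun ε : ℝ => (1 - lam' / 2 * h) * (riemannianDist G x y + ε)) (𝓝[>] 0)
      (𝓝 ((1 - lam' / 2 * h) * (riemannianDist G x y + 0))) := by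
    have : Continuous fun ε : ℝ => (1 - lam' / 2 * h) * (riemannianDist G x y + ε) := by fun_prop
    exact (this.tendsto 0).mono_left nhdsWithin_le_nhds
  rw [add_zero] at hlim
  refine ge_of_tendsto hlim ?_
  filter_upwards [Ioc_mem_nhdsGT one_pos] with ε hε using key ε hε.1 hε.2

/-! ### The differential inequality for the distance of two curves -/

/-- A differentiable curve stays `o(h)`-close to its tangent line for `d_G`. -/
lemma eventually_dist_tangent_le {ζ : ℝ → E n} {w : E n} {t : ℝ} (hζ : HasDerivAt ζ w t) {ε : ℝ}
    (hε : 0 < ε) :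
    ∀ᶠ h in 𝓝[>] (0 : ℝ), (riemannianDist G (ζ (t + h)) (ζ t + h • w) : ℝ) ≤ ε * h := by
  obtain ⟨C, hC, hle⟩ := hG.exists_riemannianDist_le (‖ζ t‖ + 1)
  have hlittle := (hasDerivAt_iff_isLittleO_nhds_zero.1 hζ).def (show 0 < ε / C by positivity)
  have hball : Metric.ball (ζ t) 1 ⊆ Metric.closedBall (0 : E n) (‖ζ t‖ + 1) := fun y hy => by
    rw [mem_ball_iff_norm] at hy
    rw [mem_closedBall_zero_iff]
    linarith [norm_le_norm_add_norm_sub' y (ζ t)]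
  have h1 : ∀ᶠ h in 𝓝 (0 : ℝ), ζ (t + h) ∈ Metric.ball (ζ t) 1 := by
    have : Tendsto (fun h => ζ (t + h)) (𝓝 0) (𝓝 (ζ t)) :=
      Tendsto.comp hζ.continuousAt (by
        have : Continuous fun h : ℝ => t + h := by fun_prop
        simpa using this.tendsto 0)
    exact this (Metric.ball_mem_nhds _ one_pos)
  have h2 : ∀ᶠ h in 𝓝 (0 : ℝ), ζ t + h • w ∈ Metric.ball (ζ t) 1 := by
    have : Continuous fun h : ℝ => ζ t + h • w := by fun_prop
    exact this.tendsto' 0 (ζ t) (by simp) (Metric.ball_mem_nhds _ one_pos)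
  filter_upwards [nhdsWithin_le_nhds hlittle, nhdsWithin_le_nhds h1, nhdsWithin_le_nhds h2,
    self_mem_nhdsWithin] with h hh hh1 hh2 hpos
  refine (hle _ (hball hh1) _ (hball hh2)).trans ?_
  rw [Real.norm_of_nonneg (le_of_lt hpos), sub_sub] at hh
  calc C * ‖ζ (t + h) - (ζ t + h • w)‖ ≤ C * (ε / C * h) := by gcongr
    _ = ε * h := by field_simp

/-- Moving a point by `h e` changes it by at most `h (|e|_G + o(1))`, locally uniformly. -/
lemma eventually_dist_shift_le (y w e : E n) {ε : ℝ} (hε : 0 < ε) :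
    ∀ᶠ h in 𝓝[>] (0 : ℝ), (riemannianDist G (y + h • w) (y + h • (w + e)) : ℝ) ≤
      h * (gnorm (G y) e + ε) := by
  have hcont : Continuous fun z => gnorm (G z) e :=
    hG.continuous_gnorm.comp (by fun_prop : Continuous fun z => (z, e))
  obtain ⟨r, hr, hball⟩ := Metric.eventually_nhds_iff.1
    (hcont.tendsto y (Iio_mem_nhds (show gnorm (G y) e < gnorm (G y) e + ε by linarith)))
  have h1 : ∀ᶠ h in 𝓝 (0 : ℝ), h * (‖w‖ + ‖e‖) < r := by
    have : Continuous fun h : ℝ => h * (‖w‖ + ‖e‖) := by fun_prop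
    exact this.tendsto' 0 0 (by simp) (Iio_mem_nhds hr)
  filter_upwards [nhdsWithin_le_nhds h1, self_mem_nhdsWithin] with h hh hpos
  have hpos : 0 < h := hpos
  refine hG.riemannianDist_le_of_segment fun s hs => ?_
  have hz : y + h • (w + e) - (y + h • w) = h • e := by module
  rw [hz, gnorm_smul, abs_of_pos hpos]
  gcongr
  refine le_of_lt (hball ?_)
  rw [dist_eq_norm]
  have : y + h • w + s • h • e - y = h • (w + s • e) := by module
  rw [this, norm_smul, Real.norm_of_nonneg hpos.le]
  refine lt_of_le_of_lt ?_ hh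
  gcongr
  refine (norm_add_le _ _).trans ?_
  gcongr
  rw [norm_smul, Real.norm_of_nonneg hs.1]
  exact mul_le_of_le_one_left (norm_nonneg _) hs.2

/-- The distance of an integral curve of a contracting field and a curve with the defect `e`
satisfies `D' ≤ -(lam/2) D + |e|_G` wherever it is differentiable. -/
theorem deriv_dist_le (hcomplete : IsCompleteDist (riemannianDist G)) {g : E n → E n}
    (hg : ContDiff ℝ ∞ g) {lam : ℝ} (hlam : 0 < lam) (hc : ContractsField G g lam)
    {ξ η : ℝ → E n} {e : E n} {t D' : ℝ} (hξ : HasDerivAt ξ (g (ξ t)) t)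
    (hη : HasDerivAt η (g (η t) + e) t)
    (hD : HasDerivAt (fun s => (riemannianDist G (ξ s) (η s) : ℝ)) D' t) :
    D' ≤ -(lam / 2) * riemannianDist G (ξ t) (η t) + gnorm (G (η t)) e := by
  set D := NNReal.toReal (riemannianDist G (ξ t) (η t))
  have key (lam' : ℝ) (h0 : 0 < lam') (hl : lam' < lam) (ε : ℝ) (hε : 0 < ε) :
      D' ≤ -(lam' / 2) * D + gnorm (G (η t)) e + 3 * ε := by
    obtain ⟨δ, hδ, hstep⟩ := hG.exists_step_dist_le hcomplete hg hc h0 hl (ξ t) (η t)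
    have hslope : Tendsto (fun h => h⁻¹ * ((riemannianDist G (ξ (t + h)) (η (t + h)) : ℝ) - D))
        (𝓝[>] 0) (𝓝 D') := by
      simpa using hD.tendsto_slope_zero_right
    refine le_of_tendsto hslope ?_
    filter_upwards [hG.eventually_dist_tangent_le hξ hε, hG.eventually_dist_tangent_le hη hε,
      hG.eventually_dist_shift_le (η t) (g (η t)) e hε, Ioo_mem_nhdsGT hδ] with h h1 h2 h3 hh
    rw [inv_mul_le_iff₀ hh.1]
    have h4 := hstep h ⟨hh.1.le, hh.2⟩
    have t1 := hG.riemannianDist_triangle (ξ (t + h)) (ξ t + h • g (ξ t)) (η (t + h))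
    have t2 := hG.riemannianDist_triangle (ξ t + h • g (ξ t)) (η t + h • g (η t)) (η (t + h))
    have t3 := hG.riemannianDist_triangle (η t + h • g (η t)) (η t + h • (g (η t) + e))
      (η (t + h))
    rw [hG.isMetric.symm (η t + h • (g (η t) + e)) (η (t + h))] at t3
    simp only [← NNReal.coe_le_coe, NNReal.coe_add] at t1 t2 t3
    linarith
  have hlim : Tendsto (fun ε : ℝ => -((lam - ε) / 2) * D + gnorm (G (η t)) e + 3 * ε) (𝓝[>] 0)
      (𝓝 (-(lam / 2) * D + gnorm (G (η t)) e)) := by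
    have : Continuous fun ε : ℝ => -((lam - ε) / 2) * D + gnorm (G (η t)) e + 3 * ε := by fun_prop
    exact (this.tendsto' 0 _ (by simp)).mono_left nhdsWithin_le_nhds
  refine ge_of_tendsto hlim ?_
  filter_upwards [Ioo_mem_nhdsGT hlam] with ε hε
  exact key _ (by linarith [hε.2]) (by linarith [hε.1]) ε hε.1

end IsRiemannianMetric

/-! ### Absolutely continuous functions -/

lemma _root_.AbsolutelyContinuousOnInterval.of_dist_le {X Y Z : Type*} [PseudoMetricSpace X]
    [PseudoMetricSpace Y] [PseudoMetricSpace Z] {f : ℝ → X} {g : ℝ → Y} {k : ℝ → Z} {a b : ℝ}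
    (C : ℝ) (hf : AbsolutelyContinuousOnInterval f a b) (hg : AbsolutelyContinuousOnInterval g a b)
    (h : ∀ s ∈ uIcc a b, ∀ t ∈ uIcc a b,
      dist (k s) (k t) ≤ C * (dist (f s) (f t) + dist (g s) (g t))) :
    AbsolutelyContinuousOnInterval k a b := by
  unfold AbsolutelyContinuousOnInterval at hf hg
  refine squeeze_zero' (.of_forall fun _ => Finset.sum_nonneg fun _ _ => dist_nonneg) ?_
    (by simpa using (hf.add hg).const_mul C)
  rw [eventually_inf_principal]
  refine .of_forall fun e he => ?_
  rw [← Finset.sum_add_distrib, Finset.mul_sum]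
  exact Finset.sum_le_sum fun i hi => h _ (he.1 i hi).1 _ (he.1 i hi).2

lemma _root_.AbsolutelyContinuousOnInterval.congr {X : Type*} [PseudoMetricSpace X]
    {f g : ℝ → X} {a b : ℝ} (hf : AbsolutelyContinuousOnInterval f a b)
    (h : EqOn f g (uIcc a b)) : AbsolutelyContinuousOnInterval g a b :=
  hf.of_dist_le 1 hf fun s hs t ht => by
    rw [h hs, h ht]
    linarith [dist_nonneg (x := g s) (y := g t)]

/-- A monotone map which does not increase distances maps disjoint intervals to disjoint intervals
of no larger total length. -/
lemma _root_.AbsolutelyContinuousOnInterval.comp_monotone {X : Type*} [PseudoMetricSpace X]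
    {f : ℝ → X} {φ : ℝ → ℝ} {a b c d : ℝ} (hf : AbsolutelyContinuousOnInterval f c d)
    (hφ : Monotone φ) (hlip : ∀ s t, dist (φ s) (φ t) ≤ dist s t)
    (hmaps : MapsTo φ (uIcc a b) (uIcc c d)) :
    AbsolutelyContinuousOnInterval (fun s => f (φ s)) a b := by
  rw [absolutelyContinuousOnInterval_iff] at hf ⊢
  intro ε hε
  obtain ⟨δ, hδ, h⟩ := hf ε hε
  refine ⟨δ, hδ, fun e he hlen => ?_⟩
  refine h (e.1, fun i => (φ (e.2 i).1, φ (e.2 i).2)) ⟨fun i hi => ?_, ?_⟩ ?_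
  · exact ⟨hmaps (he.1 i hi).1, hmaps (he.1 i hi).2⟩
  · -- a common point of two image intervals comes from a common point of the original ones
    intro i hi j hj hij
    refine Set.disjoint_left.2 fun y hy hy' => ?_
    have hinv {s t y : ℝ} (hy : y ∈ uIoc (φ s) (φ t)) :
        ∃ p q, min s t = p ∧ max s t = q ∧ p < q ∧ φ p < y ∧ y ≤ φ q := by
      refine ⟨_, _, rfl, rfl, ?_⟩
      rw [uIoc, mem_Ioc, ← hφ.map_min, ← hφ.map_max] at hy
      refine ⟨?_, hy⟩
      by_contra! hle
      exact absurd (hφ hle) (not_le.2 (hy.1.trans_le hy.2))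
    obtain ⟨p, q, hp, hq, hpq, hpy, hyq⟩ := hinv hy
    obtain ⟨p', q', hp', hq', hpq', hpy', hyq'⟩ := hinv hy'
    have h1 : p < q' := by
      by_contra! hle
      exact absurd (hyq'.trans (hφ hle)) (not_le.2 hpy)
    have h2 : p' < q := by
      by_contra! hle
      exact absurd (hyq.trans (hφ hle)) (not_le.2 hpy')
    have m1 : min q q' ∈ uIoc (e.2 i).1 (e.2 i).2 := by
      rw [uIoc, hp, hq]
      exact ⟨lt_min hpq h1, min_le_left _ _⟩
    have m2 : min q q' ∈ uIoc (e.2 j).1 (e.2 j).2 := by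
      rw [uIoc, hp', hq']
      exact ⟨lt_min h2 hpq', min_le_right _ _⟩
    exact Set.disjoint_left.1 (he.2 hi hj hij) m1 m2
  · exact (Finset.sum_le_sum fun i _ => hlip _ _).trans_lt hlen

/-- Up to a constant, `f` is the sum of its compositions with the maps which clamp the parameter to
the two sides of `c`, and these are absolutely continuous. -/
lemma _root_.AbsolutelyContinuousOnInterval.trans {F : Type*} [SeminormedAddCommGroup F]
    {f : ℝ → F} {a b c : ℝ} (h1 : AbsolutelyContinuousOnInterval f a c)
    (h2 : AbsolutelyContinuousOnInterval f c b) : AbsolutelyContinuousOnInterval f a b := by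
  have key {a b : ℝ} (hac : a ≤ c) (hcb : c ≤ b) (h1 : AbsolutelyContinuousOnInterval f a c)
      (h2 : AbsolutelyContinuousOnInterval f c b) : AbsolutelyContinuousOnInterval f a b := by
    have hab := hac.trans hcb
    have e1 : AbsolutelyContinuousOnInterval (fun s => f (min s c)) a b := by
      refine h1.comp_monotone (fun s t h => min_le_min_right _ h) (fun s t => ?_) fun s hs => ?_
      · rw [Real.dist_eq, Real.dist_eq]
        exact abs_min_sub_min_le_max s c t c |>.trans (by simp)
      · rw [uIcc_of_le hab] at hs
        rw [uIcc_of_le hac]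
        exact ⟨le_min hs.1 hac, min_le_right _ _⟩
    have e2 : AbsolutelyContinuousOnInterval (fun s => f (max s c)) a b := by
      refine h2.comp_monotone (fun s t h => max_le_max_right _ h) (fun s t => ?_) fun s hs => ?_
      · rw [Real.dist_eq, Real.dist_eq]
        exact abs_max_sub_max_le_max s c t c |>.trans (by simp)
      · rw [uIcc_of_le hab] at hs
        rw [uIcc_of_le hcb]
        exact ⟨le_max_right _ _, max_le hs.2 hcb⟩
    have hsum (s : ℝ) : f s = f (min s c) + f (max s c) - f c := by
      rcases le_total s c with h | h <;> simp [h]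
    refine e1.of_dist_le 1 e2 fun s _ t _ => ?_
    rw [one_mul, dist_eq_norm, dist_eq_norm, dist_eq_norm, hsum s, hsum t]
    refine le_trans (le_of_eq ?_) (norm_add_le _ _)
    congr 1
    abel
  rcases le_total a c with hac | hac <;> rcases le_total c b with hcb | hcb
  · exact key hac hcb h1 h2
  · rcases le_total a b with hab | hab
    · exact h1.mono (by grind [uIcc_of_le])
    · exact h2.mono (by grind [uIcc_of_le, uIcc_of_ge])
  · rcases le_total a b with hab | hab
    · exact h2.mono (by grind [uIcc_of_le, uIcc_of_ge])
    · exact h1.mono (by grind [uIcc_of_le, uIcc_of_ge])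
  · exact (key hcb hac h2.symm h1.symm).symm

/-- Gronwall's inequality for the differential inequality `D' ≤ -k D + c`, which an absolutely
continuous function satisfies almost everywhere. -/
lemma le_of_ae_deriv_le {D : ℝ → ℝ} {k c T : ℝ} (hk : 0 < k) (hc : 0 ≤ c) (hT : 0 ≤ T)
    (hD : AbsolutelyContinuousOnInterval D 0 T)
    (h : ∀ᵐ t : ℝ, t ∈ Icc 0 T → ∀ D', HasDerivAt D D' t → D' ≤ -k * D t + c) :
    D T ≤ Real.exp (-k * T) * D 0 + c / k := by
  -- the function `exp(k t) (D(t) - c/k)` is nonincreasing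
  have hexp : AbsolutelyContinuousOnInterval (fun t => Real.exp (k * t)) 0 T :=
    ContDiffOn.absolutelyContinuousOnInterval (by fun_prop)
  have hconst : AbsolutelyContinuousOnInterval (fun _ : ℝ => c / k) 0 T :=
    ContDiffOn.absolutelyContinuousOnInterval (by fun_prop)
  have hsub : AbsolutelyContinuousOnInterval (fun t => D t - c / k) 0 T := hD.sub hconst
  have hac : AbsolutelyContinuousOnInterval (fun t => Real.exp (k * t) * (D t - c / k)) 0 T :=
    hexp.mul hsub
  have hftc := hac.integral_deriv_eq_sub
  have hle : ∫ t in (0 : ℝ)..T, deriv (fun t => Real.exp (k * t) * (D t - c / k)) t ≤ 0 := by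
    rw [intervalIntegral.integral_of_le hT]
    refine integral_nonpos_of_ae ((ae_restrict_iff' measurableSet_Ioc).2 ?_)
    filter_upwards [h, hD.ae_differentiableAt] with t ht hd htT
    have htT' : t ∈ Icc 0 T := ⟨htT.1.le, htT.2⟩
    have hd := (hd (by rwa [uIcc_of_le hT])).hasDerivAt
    have hE : HasDerivAt (fun t => Real.exp (k * t)) (Real.exp (k * t) * k) t := by
      simpa using ((hasDerivAt_id t).const_mul k).exp
    have := (hE.mul (hd.sub_const (c / k))).deriv
    change deriv (fun t => Real.exp (k * t) * (D t - c / k)) t = _ at this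
    rw [this]
    have hb := ht htT' _ hd
    have hpos := Real.exp_pos (k * t)
    have : Real.exp (k * t) * k * (D t - c / k) + Real.exp (k * t) * deriv D t =
        Real.exp (k * t) * (deriv D t - (-k * D t + c)) := by field_simp; ring
    rw [this]
    exact mul_nonpos_of_nonneg_of_nonpos hpos.le (by linarith)
  rw [hftc] at hle
  simp only [mul_zero, Real.exp_zero, one_mul] at hle
  have hck : 0 ≤ c / k := by positivity
  have he : Real.exp (-k * T) * Real.exp (k * T) = 1 := by
    rw [← Real.exp_add]; simp
  have hp := Real.exp_pos (-k * T)
  have := mul_le_mul_of_nonneg_left hle hp.le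
  rw [mul_sub, ← mul_assoc, he, mul_zero] at this
  nlinarith

/-! ### Contraction of trajectories -/

lemma ControlSystem.IsSmooth.contDiff_state {S : ControlSystem n m} (hS : S.IsSmooth) {u : E m}
    (hu : u ∈ S.U) : ContDiff ℝ ∞ fun x => S.f x u :=
  contDiff_iff_contDiffAt.2 fun x =>
    (hS x u hu).comp x (f := fun x : E n => (x, u)) (by fun_prop)

lemma ControlSystem.IsSmooth.differentiableAt_input {S : ControlSystem n m} (hS : S.IsSmooth)
    (x : E n) {u : E m} (hu : u ∈ S.U) : DifferentiableAt ℝ (fun v => S.f x v) u :=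
  ((hS x u hu).comp u (f := fun v : E m => (x, v)) (by fun_prop)).differentiableAt (by simp)

lemma IsRiemannianMetric.absolutelyContinuousOnInterval_dist (hG : IsRiemannianMetric G)
    {ξ η : ℝ → E n} {a b : ℝ} (hξ : AbsolutelyContinuousOnInterval ξ a b)
    (hη : AbsolutelyContinuousOnInterval η a b) :
    AbsolutelyContinuousOnInterval (fun t => (riemannianDist G (ξ t) (η t) : ℝ)) a b := by
  obtain ⟨A, hA⟩ := hξ.exists_bound
  obtain ⟨B, hB⟩ := hη.exists_bound
  obtain ⟨C, hC, hle⟩ := hG.exists_riemannianDist_le (max A B)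
  have hA' {t : ℝ} (ht : t ∈ uIcc a b) : ξ t ∈ Metric.closedBall (0 : E n) (max A B) := by
    simpa using Or.inl (hA t ht)
  have hB' {t : ℝ} (ht : t ∈ uIcc a b) : η t ∈ Metric.closedBall (0 : E n) (max A B) := by
    simpa using Or.inr (hB t ht)
  have key {s t : ℝ} (hs : s ∈ uIcc a b) (ht : t ∈ uIcc a b) :
      (riemannianDist G (ξ s) (η s) : ℝ) - riemannianDist G (ξ t) (η t) ≤
        C * (dist (ξ s) (ξ t) + dist (η s) (η t)) := by
    have t1 := hG.riemannianDist_triangle (ξ s) (ξ t) (η s)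
    have t2 := hG.riemannianDist_triangle (ξ t) (η t) (η s)
    simp only [← NNReal.coe_le_coe, NNReal.coe_add] at t1 t2
    have d1 := hle _ (hA' hs) _ (hA' ht)
    have d2 := hle _ (hB' ht) _ (hB' hs)
    rw [dist_eq_norm, dist_eq_norm, norm_sub_rev (η s)]
    linarith
  refine hξ.of_dist_le C hη fun s hs t ht => ?_
  rw [Real.dist_eq, abs_sub_le_iff]
  refine ⟨key hs ht, ?_⟩
  rw [dist_comm (ξ s), dist_comm (η s)]
  exact key ht hs

/-- The estimate behind all comparisons of trajectories: `η` need not be a trajectory, but follows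
the input of `ξ` up to a defect `e` of `G`-norm at most `c`. -/
theorem dist_le_of_defect {S : ControlSystem n m} (hS : S.IsSmooth) (hG : IsRiemannianMetric G)
    (hcomplete : IsCompleteDist (riemannianDist G)) {lam : ℝ} (hlam : 0 < lam)
    (hcon : ContractsStates S G lam) {ξ η : ℝ → E n} {c T : ℝ} (hc : 0 ≤ c) (hT : 0 ≤ T)
    (hξ : AbsolutelyContinuousOnInterval ξ 0 T) (hη : AbsolutelyContinuousOnInterval η 0 T)
    (h : ∀ᵐ t : ℝ, t ∈ Icc 0 T → ∃ u ∈ S.U, ∃ e : E n, HasDerivAt ξ (S.f (ξ t) u) t ∧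
      HasDerivAt η (S.f (η t) u + e) t ∧ gnorm (G (η t)) e ≤ c) :
    (riemannianDist G (ξ T) (η T) : ℝ) ≤
      Real.exp (-(lam / 2) * T) * riemannianDist G (ξ 0) (η 0) + c / (lam / 2) := by
  refine le_of_ae_deriv_le (D := fun t => (riemannianDist G (ξ t) (η t) : ℝ)) (half_pos hlam) hc hT
    (hG.absolutelyContinuousOnInterval_dist hξ hη) ?_
  filter_upwards [h] with t ht htT D' hD'
  obtain ⟨u, hu, e, h1, h2, h3⟩ := ht htT
  have := hG.deriv_dist_le hcomplete (g := fun x => S.f x u) (hS.contDiff_state hu) hlam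
    (hcon u hu) h1 h2 hD'
  linarith

lemma ControlSystem.IsTrajectory.absolutelyContinuousOnInterval {S : ControlSystem n m}
    {I : Set ℝ} {υ : ℝ → E m} {ξ : ℝ → E n} (h : S.IsTrajectory I υ ξ) {t : ℝ} (ht : t ∈ I) :
    AbsolutelyContinuousOnInterval ξ 0 t :=
  h.absCont 0 h.input.interval.2.2 t ht

lemma IsTimeInterval.Icc_subset {I : Set ℝ} (hI : IsTimeInterval I) {t : ℝ} (ht : t ∈ I) :
    Icc 0 t ⊆ I :=
  hI.2.1.out hI.2.2 ht

theorem dist_le_of_contractsStates {S : ControlSystem n m} (hS : S.IsSmooth)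
    (hG : IsRiemannianMetric G) (hcomplete : IsCompleteDist (riemannianDist G)) {lam : ℝ}
    (hlam : 0 < lam) (hcon : ContractsStates S G lam) {I I' : Set ℝ} {υ : ℝ → E m}
    {ξ ξ' : ℝ → E n} (hξ : S.IsTrajectory I υ ξ) (hξ' : S.IsTrajectory I' υ ξ') {t : ℝ}
    (ht : 0 ≤ t) (htI : t ∈ I) (htI' : t ∈ I') :
    (riemannianDist G (ξ t) (ξ' t) : ℝ) ≤
      Real.exp (-(lam / 2) * t) * riemannianDist G (ξ 0) (ξ' 0) := by
  have := dist_le_of_defect hS hG hcomplete hlam hcon le_rfl ht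
    (hξ.absolutelyContinuousOnInterval htI) (hξ'.absolutelyContinuousOnInterval htI') (by
      filter_upwards [hξ.deriv_eq, hξ'.deriv_eq] with s h1 h2 hs
      have hsI := hξ.input.interval.Icc_subset htI hs
      refine ⟨υ s, hξ.input.mem s hsI, 0, h1 hsI, ?_, by simp [gnorm, form]⟩
      rw [add_zero]
      exact h2 (hξ'.input.interval.Icc_subset htI' hs))
  simpa using this

/-- Forward uniqueness, as a consequence of the contraction estimate. -/
lemma trajectory_unique {S : ControlSystem n m} (hS : S.IsSmooth)
    (hG : IsRiemannianMetric G) (hcomplete : IsCompleteDist (riemannianDist G)) {lam : ℝ}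
    (hlam : 0 < lam) (hcon : ContractsStates S G lam) {I I' : Set ℝ} {υ : ℝ → E m}
    {ξ ξ' : ℝ → E n} (hξ : S.IsTrajectory I υ ξ) (hξ' : S.IsTrajectory I' υ ξ') (h0 : ξ 0 = ξ' 0)
    {t : ℝ} (ht : 0 ≤ t) (htI : t ∈ I) (htI' : t ∈ I') : ξ t = ξ' t := by
  have := dist_le_of_contractsStates hS hG hcomplete hlam hcon hξ hξ' ht htI htI'
  rw [h0, (hG.isMetric.eq_zero_iff (ξ' 0) (ξ' 0)).2 rfl, NNReal.coe_zero, mul_zero] at this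
  exact (hG.isMetric.eq_zero_iff _ _).1
    (NNReal.coe_injective (le_antisymm this (NNReal.coe_nonneg _)))

/-! ### Contraction with respect to inputs -/

lemma sqrt_form_one (w : E m) : √(form 1 w.ofLp w.ofLp) = ‖w‖ := by
  rw [EuclideanSpace.norm_eq]
  simp [form, dotProduct, sq]

lemma ContractsStatesInputs.contractsStates {S : ControlSystem n m} {lam α : ℝ}
    (h : ContractsStatesInputs S G lam α) : ContractsStates S G lam := fun u hu x X => by
  simpa [form] using h u hu x X 0

/-- Letting `X` tend to `0` in the contraction inequality, only the terms linear in `X` survive. -/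
lemma ContractsStatesInputs.form_dfdu_le {S : ControlSystem n m} {lam α : ℝ}
    (h : ContractsStatesInputs S G lam α) {u : E m} (hu : u ∈ S.U) (x X : E n) (Y : E m) :
    2 * form (G x) (dfdu S x u *ᵥ Y.ofLp) X.ofLp ≤ α * gnorm (G x) X * ‖Y‖ := by
  have hlim : Tendsto (fun ε : ℝ => α * gnorm (G x) X * ‖Y‖ + ε * (-lam * form (G x) X.ofLp X.ofLp -
      form (contractionMatrix S G x u) X.ofLp X.ofLp)) (𝓝[>] 0)
      (𝓝 (α * gnorm (G x) X * ‖Y‖)) := by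
    have : Continuous fun ε : ℝ => α * gnorm (G x) X * ‖Y‖ + ε * (-lam * form (G x) X.ofLp X.ofLp -
      form (contractionMatrix S G x u) X.ofLp X.ofLp) := by fun_prop
    exact (this.tendsto' 0 _ (by simp)).mono_left nhdsWithin_le_nhds
  refine ge_of_tendsto hlim ?_
  filter_upwards [self_mem_nhdsWithin] with ε hε
  have hε : 0 < ε := hε
  have := h u hu x (ε • X.ofLp) Y.ofLp
  have hs : √(form (G x) (ε • X.ofLp) (ε • X.ofLp)) = ε * gnorm (G x) X := by
    have := gnorm_smul (G x) ε X
    rwa [abs_of_pos hε] at this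
  have hl (v : Fin n → ℝ) : form (G x) v (ε • X.ofLp) = ε * form (G x) v X.ofLp := by
    simp [form, Matrix.mulVec_smul]
  rw [hs, hl, form_smul_smul, form_smul_smul, sqrt_form_one] at this
  refine le_of_mul_le_mul_left ?_ hε
  linarith

/-- The mean value inequality for `f(x, ·)` on the segment between two inputs, which lies in `S.U`
by convexity; the curve of velocities is tested against its own increment `e`. -/
lemma ContractsStatesInputs.gnorm_sub_le {S : ControlSystem n m} (hS : S.IsSmooth)
    (hU : Convex ℝ S.U) (hG : IsRiemannianMetric G) {lam α : ℝ} (hα : 0 ≤ α)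
    (h : ContractsStatesInputs S G lam α) {u u' : E m} (hu : u ∈ S.U) (hu' : u' ∈ S.U) (x : E n) :
    gnorm (G x) (S.f x u' - S.f x u) ≤ α / 2 * ‖u' - u‖ := by
  set e := S.f x u' - S.f x u
  have hd (s : ℝ) (hs : s ∈ Icc (0 : ℝ) 1) :
      HasDerivAt (fun s => form (G x) (S.f x (u + s • (u' - u))).ofLp e.ofLp)
        (form (G x) (dfdu S x (u + s • (u' - u)) *ᵥ (u' - u).ofLp) e.ofLp) s := by
    have hmem := hU.add_smul_sub_mem hu hu' hs
    have h1 : HasDerivAt (fun s : ℝ => u + s • (u' - u)) (u' - u) s := by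
      simpa using ((hasDerivAt_id s).smul_const (u' - u)).const_add u
    have h2 := (hS.differentiableAt_input x hmem).hasFDerivAt.comp_hasDerivAt s h1
    have h3 := hasDerivAt_form (M := fun _ => G x) (M' := 0)
      (fun i j => hasDerivAt_const s (G x i j)) h2 (hasDerivAt_const s e)
    refine h3.congr_deriv ?_
    rw [dfdu, jacobian_mulVec]
    simp [form]
  have hmv := (convex_Icc (0 : ℝ) 1).image_sub_le_mul_sub_of_deriv_le
    (fun s hs => (hd s hs).continuousAt.continuousWithinAt)
    (fun s hs => (hd s (interior_subset hs)).differentiableAt.differentiableWithinAt)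
    (C := α / 2 * gnorm (G x) e * ‖u' - u‖) (fun s hs => by
      have hs := interior_subset hs
      rw [(hd s hs).deriv]
      have := h.form_dfdu_le (hU.add_smul_sub_mem hu hu' hs) x e (u' - u)
      linarith) 0 ⟨le_rfl, zero_le_one⟩ 1 ⟨zero_le_one, le_rfl⟩ zero_le_one
  simp only [one_smul, zero_smul, add_zero, add_sub_cancel, sub_zero, mul_one] at hmv
  have hee : form (G x) (S.f x u').ofLp e.ofLp - form (G x) (S.f x u).ofLp e.ofLp =
      gnorm (G x) e ^ 2 := by
    rw [hG.gnorm_sq]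
    simp [form, e, sub_dotProduct]
  rw [hee] at hmv
  rcases (gnorm_nonneg (G x) e).eq_or_lt with h0 | hpos
  · rw [← h0]
    positivity
  · refine le_of_mul_le_mul_left ?_ hpos
    linarith

theorem dist_le_of_contractsStatesInputs {S : ControlSystem n m} (hS : S.IsSmooth)
    (hU : Convex ℝ S.U) (hG : IsRiemannianMetric G)
    (hcomplete : IsCompleteDist (riemannianDist G)) {lam α : ℝ}
    (hlam : 0 < lam) (hα : 0 ≤ α) (hcon : ContractsStatesInputs S G lam α) {I I' : Set ℝ}
    {υ υ' : ℝ → E m} {ξ ξ' : ℝ → E n} (hξ : S.IsTrajectory I υ ξ) (hξ' : S.IsTrajectory I' υ' ξ')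
    (hfin : inputDist I I' υ υ' ≠ ⊤) {t : ℝ} (ht : 0 ≤ t) (htI : t ∈ I) (htI' : t ∈ I') :
    (riemannianDist G (ξ t) (ξ' t) : ℝ) ≤
      Real.exp (-(lam / 2) * t) * riemannianDist G (ξ 0) (ξ' 0) +
        α / lam * (inputDist I I' υ υ').toReal := by
  have hmeas : MeasurableSet (I ∩ I' ∩ Ici 0) :=
    (hξ.input.interval.1.measurableSet.inter hξ'.input.interval.1.measurableSet).inter
      measurableSet_Ici
  have hess : ∀ᵐ s : ℝ, s ∈ I ∩ I' ∩ Ici 0 → ‖υ s - υ' s‖ ≤ (inputDist I I' υ υ').toReal := by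
    refine (ae_restrict_iff' hmeas).1 ?_
    have := ae_le_eLpNormEssSup (f := fun s => υ s - υ' s)
      (μ := volume.restrict (I ∩ I' ∩ Ici 0))
    rw [← eLpNorm_exponent_top] at this
    filter_upwards [this] with s hs
    rw [← toReal_enorm]
    exact ENNReal.toReal_mono hfin hs
  have := dist_le_of_defect hS hG hcomplete hlam hcon.contractsStates
    (c := α / 2 * (inputDist I I' υ υ').toReal) (by positivity) ht
    (hξ.absolutelyContinuousOnInterval htI) (hξ'.absolutelyContinuousOnInterval htI') (by
      filter_upwards [hξ.deriv_eq, hξ'.deriv_eq, hess] with s h1 h2 h3 hs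
      have hsI := hξ.input.interval.Icc_subset htI hs
      have hsI' := hξ'.input.interval.Icc_subset htI' hs
      refine ⟨υ s, hξ.input.mem s hsI, S.f (ξ' s) (υ' s) - S.f (ξ' s) (υ s), h1 hsI, ?_, ?_⟩
      · rw [add_sub_cancel]
        exact h2 hsI'
      · refine (hcon.gnorm_sub_le hS hU hG hα (hξ.input.mem s hsI)
          (hξ'.input.mem s hsI') _).trans ?_
        rw [norm_sub_rev]
        exact mul_le_mul_of_nonneg_left (h3 ⟨⟨hsI, hsI'⟩, hs.1⟩) (by positivity))
  refine this.trans (le_of_eq ?_)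
  field_simp

variable {S : ControlSystem n m}

/-! ### Local existence of trajectories -/

lemma IsInput.restrict {U : Set (E m)} {I J : Set ℝ} {υ : ℝ → E m} (h : IsInput U I υ)
    (hJI : J ⊆ I) (hJ : IsTimeInterval J) : IsInput U J υ where
  interval := hJ
  measurable := h.measurable.comp (measurable_inclusion hJI)
  mem t ht := h.mem t (hJI ht)
  locallyBounded τ hτ := by
    obtain ⟨C, hC⟩ := h.locallyBounded τ hτ
    exact ⟨C, hC.mono fun t ht htJ => ht (hJI htJ)⟩

lemma IsInput.aestronglyMeasurable {I : Set ℝ} {υ : ℝ → E m} (h : IsInput S.U I υ)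
    {x : ℝ → E n} (hx : Continuous x) {A : Set ℝ} (hA : A ⊆ I) :
    AEStronglyMeasurable (fun t => S.f (x t) (υ t)) (volume.restrict A) := by
  have hf := continuousOn_iff_continuous_domRestrict.1 S.continuousOn
  have hpair : Measurable fun t : I => (⟨(x t, υ t), mem_univ _, h.mem t t.2⟩ :
      ((univ : Set (E n)) ×ˢ S.U : Set (E n × E m))) :=
    (((hx.measurable.comp measurable_subtype_coe)).prodMk h.measurable).subtype_mk
  have := aemeasurable_restrict_of_measurable_subtype (μ := volume)
    h.interval.1.measurableSet (f := fun t => S.f (x t) (υ t)) (hf.measurable.comp hpair)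
  exact (this.mono_measure (Measure.restrict_mono hA le_rfl)).aestronglyMeasurable

/-- Picard iteration for an input which is merely measurable in time. -/
lemma exists_local_solution {I : Set ℝ} {υ : ℝ → E m} (hυ : IsInput S.U I υ) {a b t₀ M Z : ℝ}
    (hat : a ≤ t₀) (htb : t₀ ≤ b) (hI : Icc a b ⊆ I) (x₀ : E n) (hM0 : 0 ≤ M) (hZ0 : 0 ≤ Z)
    (hM : ∀ᵐ t : ℝ, t ∈ Icc a b → ∀ x ∈ Metric.closedBall x₀ 1, ‖S.f x (υ t)‖ ≤ M)
    (hZ : ∀ x ∈ Metric.closedBall x₀ 1, ∀ y ∈ Metric.closedBall x₀ 1, ∀ u ∈ S.U,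
      ‖S.f x u - S.f y u‖ ≤ Z * ‖x - y‖)
    (hMab : M * (b - a) ≤ 1) (hZab : Z * (b - a) ≤ 1 / 2) :
    ∃ ξ : ℝ → E n, ξ t₀ = x₀ ∧ AbsolutelyContinuousOnInterval ξ a b ∧
      ∀ᵐ t : ℝ, t ∈ Ioo a b → HasDerivAt ξ (S.f (ξ t) (υ t)) t := by
  have hab : a ≤ b := hat.trans htb
  have ht₀ : t₀ ∈ Icc a b := ⟨hat, htb⟩
  -- continuous curves with values in the unit ball around `x₀`
  let Y := {α : C(Icc a b, E n) // α ∈ {α : C(Icc a b, E n) | ∀ t, α t ∈ Metric.closedBall x₀ 1}}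
  have hclosed : IsClosed {α : C(Icc a b, E n) | ∀ t, α t ∈ Metric.closedBall x₀ 1} := by
    simp only [ofPred_forall]
    exact isClosed_iInter fun t => Metric.isClosed_closedBall.preimage (by fun_prop)
  have : CompleteSpace Y := hclosed.completeSpace_coe
  have : Nonempty Y := ⟨⟨ContinuousMap.const _ x₀, fun t => by simp⟩⟩
  let extend (α : Y) (t : ℝ) : E n := IccExtend hab α.1 t
  have hextc (α : Y) : Continuous (extend α) := α.1.continuous.Icc_extend'
  have hextb (α : Y) (t : ℝ) : extend α t ∈ Metric.closedBall x₀ 1 := α.2 _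
  let v (α : Y) (t : ℝ) : E n := S.f (extend α t) (υ t)
  have hvM (α : Y) : ∀ᵐ t : ℝ, t ∈ Icc a b → ‖v α t‖ ≤ M := by
    filter_upwards [hM] with t ht htab using ht htab _ (hextb α t)
  have hint (α : Y) : IntegrableOn (v α) (Icc a b) :=
    Integrable.of_bound (hυ.aestronglyMeasurable (hextc α) hI) M
      ((ae_restrict_iff' measurableSet_Icc).2 (hvM α))
  have hint' (α : Y) {s t : ℝ} (hs : s ∈ Icc a b) (ht : t ∈ Icc a b) :
      IntervalIntegrable (v α) volume s t :=
    ((hint α).mono_set (uIcc_subset_Icc hs ht)).intervalIntegrable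
  have hbound (α : Y) {s t : ℝ} (hs : s ∈ Icc a b) (ht : t ∈ Icc a b) :
      ‖∫ r in s..t, v α r‖ ≤ M * |t - s| := by
    refine intervalIntegral.norm_integral_le_of_norm_le_const_ae ?_
    filter_upwards [hvM α] with r hr hrs
    exact hr (uIcc_subset_Icc hs ht (uIoc_subset_uIcc hrs))
  have hlip (α : Y) {s t : ℝ} (hs : s ∈ Icc a b) (ht : t ∈ Icc a b) :
      dist (x₀ + ∫ r in t₀..s, v α r) (x₀ + ∫ r in t₀..t, v α r) ≤ M * dist s t := by
    rw [dist_add_left, dist_eq_norm,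
      intervalIntegral.integral_interval_sub_left (hint' α ht₀ hs) (hint' α ht₀ ht), Real.dist_eq]
    exact hbound α ht hs
  have hlen {s t : ℝ} (hs : s ∈ Icc a b) (ht : t ∈ Icc a b) : |t - s| ≤ b - a := by
    rw [abs_sub_le_iff]
    constructor <;> linarith [hs.1, hs.2, ht.1, ht.2]
  have hpic (α : Y) : ∃ β : Y, ∀ t : Icc a b, β.1 t = x₀ + ∫ r in t₀..t, v α r := by
    have hc : Continuous fun t : Icc a b => x₀ + ∫ r in t₀..t, v α r :=
      (LipschitzWith.of_dist_le_mul (K := M.toNNReal) fun s t => by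
        rw [Real.coe_toNNReal _ hM0]
        exact hlip α s.2 t.2).continuous
    refine ⟨⟨⟨_, hc⟩, fun t => ?_⟩, fun t => rfl⟩
    rw [mem_closedBall_iff_norm]
    change ‖x₀ + (∫ r in t₀..t, v α r) - x₀‖ ≤ 1
    rw [add_sub_cancel_left]
    refine (hbound α ht₀ t.2).trans (le_trans ?_ hMab)
    exact mul_le_mul_of_nonneg_left (hlen ht₀ t.2) hM0
  -- `P` is the Picard operator
  choose P hP using hpic
  have hcontr : ContractingWith (1 / 2) P := by
    refine ⟨by norm_num, LipschitzWith.of_dist_le_mul fun α β => ?_⟩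
    rw [Subtype.dist_eq]
    refine (ContinuousMap.dist_le (by positivity)).2 fun t => ?_
    rw [hP, hP, dist_add_left, dist_eq_norm,
      ← intervalIntegral.integral_sub (hint' α ht₀ t.2) (hint' β ht₀ t.2)]
    have hle : ‖∫ r in t₀..t, (v α r - v β r)‖ ≤ Z * dist α β * |t - t₀| := by
      refine intervalIntegral.norm_integral_le_of_norm_le_const fun r hr => ?_
      have hrI : r ∈ Icc a b := uIcc_subset_Icc ht₀ t.2 (uIoc_subset_uIcc hr)
      refine (hZ _ (hextb α r) _ (hextb β r) _ (hυ.mem r (hI hrI))).trans ?_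
      refine mul_le_mul_of_nonneg_left ?_ hZ0
      rw [← dist_eq_norm]
      exact ContinuousMap.dist_apply_le_dist _
    refine hle.trans ?_
    have h2 : Z * |t - t₀| ≤ 1 / 2 :=
      (mul_le_mul_of_nonneg_left (hlen ht₀ t.2) hZ0).trans hZab
    have : ((1 / 2 : ℝ≥0) : ℝ) = 1 / 2 := by norm_num
    rw [this]
    nlinarith [dist_nonneg (x := α) (y := β)]
  set α := ContractingWith.fixedPoint P hcontr
  have hα : P α = α := hcontr.fixedPoint_isFixedPt
  have hsol (t : ℝ) (ht : t ∈ Icc a b) : extend α t = x₀ + ∫ r in t₀..t, v α r := by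
    have := hP α ⟨t, ht⟩
    rw [hα] at this
    simp only [extend, IccExtend_of_mem hab _ ht, this]
  refine ⟨extend α, ?_, ?_, ?_⟩
  · simpa using hsol t₀ ht₀
  · refine LipschitzOnWith.absolutelyContinuousOnInterval (K := M.toNNReal) ?_
    rw [uIcc_of_le hab]
    refine LipschitzOnWith.of_dist_le_mul fun s hs t ht => ?_
    rw [hsol s hs, hsol t ht, Real.coe_toNNReal _ hM0]
    exact hlip α hs ht
  · have := (hint' α ⟨le_rfl, hab⟩ ⟨hab, le_rfl⟩).ae_hasDerivAt_integral
    rw [uIcc_of_le hab] at this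
    filter_upwards [this] with t ht hto
    refine ((ht ⟨hto.1.le, hto.2.le⟩ t₀ ht₀).const_add x₀).congr_of_eventuallyEq ?_
    filter_upwards [Ioo_mem_nhds hto.1 hto.2] with s hs using hsol s ⟨hs.1.le, hs.2.le⟩

/-! ### Forward completeness -/

/-- For each state `x`, the map `f(x, ·)` is bounded on bounded sets of inputs. For an input set
which is not closed this does not follow from continuity. -/
def BoundedOnInputs (S : ControlSystem n m) : Prop :=
  ∀ (x : E n) (r : ℝ), ∃ C : ℝ, ∀ u ∈ S.U, ‖u‖ ≤ r → ‖S.f x u‖ ≤ C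

lemma ContractsStatesInputs.boundedOnInputs (hS : S.IsSmooth) (hU : Convex ℝ S.U)
    (hG : IsRiemannianMetric G) {lam α : ℝ} (hα : 0 ≤ α) (h : ContractsStatesInputs S G lam α) :
    BoundedOnInputs S := by
  intro x r
  rcases S.U.eq_empty_or_nonempty with hempty | ⟨u₀, hu₀⟩
  · exact ⟨0, by simp [hempty]⟩
  obtain ⟨c, hc, hle⟩ := hG.exists_le_gnorm (isCompact_singleton (x := x))
  refine ⟨‖S.f x u₀‖ + α / 2 * (r + ‖u₀‖) / c, fun u hu hur => ?_⟩
  have h1 := (hle x rfl _).trans (h.gnorm_sub_le hS hU hG hα hu₀ hu x)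
  have h2 : ‖S.f x u - S.f x u₀‖ ≤ α / 2 * (r + ‖u₀‖) / c := by
    rw [le_div_iff₀ hc, mul_comm]
    refine h1.trans (mul_le_mul_of_nonneg_left ?_ (by positivity))
    exact (norm_sub_le _ _).trans (by gcongr)
  linarith [norm_le_norm_add_norm_sub' (S.f x u) (S.f x u₀)]

lemma BoundedOnInputs.exists_velocity_bound (hb : BoundedOnInputs S) {I : Set ℝ} {υ : ℝ → E m}
    (hυ : IsInput S.U I υ) {τ : ℝ} (hτ : 0 < τ) (R : ℝ) :
    ∃ M : ℝ, 0 < M ∧ ∀ᵐ t : ℝ, t ∈ I → |t| ≤ τ →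
      ∀ x ∈ Metric.closedBall (0 : E n) R, ‖S.f x (υ t)‖ ≤ M := by
  obtain ⟨r, hr⟩ := hυ.locallyBounded τ hτ
  obtain ⟨C, hC⟩ := hb 0 r
  obtain ⟨Z, hZ, hlip⟩ := S.lipschitz _ (isCompact_closedBall (0 : E n) R)
  refine ⟨max 1 (C + Z * R), by positivity, ?_⟩
  filter_upwards [hr] with t ht htI htτ x hx
  have hR : ‖x‖ ≤ R := by simpa using hx
  have h1 := hC _ (hυ.mem t htI) (ht htI htτ)
  have h2 := hlip x hx 0 (by simpa using (norm_nonneg x).trans hR) _ (hυ.mem t htI)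
  rw [sub_zero] at h2
  refine le_trans ?_ (le_max_right _ _)
  have h3 : Z * ‖x‖ ≤ Z * R := by gcongr
  linarith [norm_le_norm_add_norm_sub' (S.f x (υ t)) (S.f 0 (υ t))]

/-- Trajectories from a given state are bounded on bounded time intervals: their distance from the
constant curve at the initial state is controlled by the contraction. -/
lemma exists_trajectory_bound (hS : S.IsSmooth) (hG : IsRiemannianMetric G)
    (hcomplete : IsCompleteDist (riemannianDist G)) {lam : ℝ} (hlam : 0 < lam)
    (hcon : ContractsStates S G lam) (hb : BoundedOnInputs S) {I : Set ℝ} {υ : ℝ → E m}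
    (hυ : IsInput S.U I υ) (x : E n) {T : ℝ} (hT : 0 < T) :
    ∃ R : ℝ, ∀ (J : Set ℝ) (ξ : ℝ → E n), J ⊆ I → S.IsTrajectory J υ ξ → ξ 0 = x →
      ∀ t ∈ J, 0 ≤ t → t ≤ T → ‖ξ t‖ ≤ R := by
  obtain ⟨M, hM, hMb⟩ := hb.exists_velocity_bound hυ hT ‖x‖
  obtain ⟨C, hC, hCb⟩ := hG.exists_gnorm_le (isCompact_singleton (x := x))
  obtain ⟨R, hR⟩ := hG.exists_norm_le hcomplete x (C * M / (lam / 2))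
  refine ⟨R, fun J ξ hJI hξ h0 t htJ ht0 htT => hR _ ?_⟩
  have hconst : AbsolutelyContinuousOnInterval (fun _ : ℝ => x) 0 t :=
    ContDiffOn.absolutelyContinuousOnInterval (by fun_prop)
  have := dist_le_of_defect hS hG hcomplete hlam hcon (c := C * M) (by positivity) ht0
    (hξ.absolutelyContinuousOnInterval htJ) hconst (by
      filter_upwards [hξ.deriv_eq, hMb] with s h1 h2 hs
      have hsJ := hξ.input.interval.Icc_subset htJ hs
      refine ⟨υ s, hξ.input.mem s hsJ, -S.f x (υ s), h1 hsJ, ?_, ?_⟩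
      · rw [add_neg_cancel]
        exact hasDerivAt_const s x
      · refine (hCb x rfl _).trans ?_
        rw [norm_neg]
        refine mul_le_mul_of_nonneg_left (h2 (hJI hsJ) ?_ x (by simp)) hC.le
        rw [abs_of_nonneg hs.1]
        exact hs.2.trans htT)
  rw [h0, (hG.isMetric.eq_zero_iff x x).2 rfl, NNReal.coe_zero, mul_zero, zero_add] at this
  rwa [hG.isMetric.symm]

lemma ControlSystem.IsTrajectory.glue {J I : Set ℝ} {υ : ℝ → E m} {ξ ζ : ℝ → E n}
    (hυ : IsInput S.U I υ) (hξ : S.IsTrajectory J υ ξ) (hJI : J ⊆ I) {t₀ b : ℝ} (ht₀ : t₀ ∈ J)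
    (htb : t₀ < b) (hbI : b ∈ I) (hJb : ∀ t ∈ J, t < b) (h0 : ζ t₀ = ξ t₀)
    (hac : AbsolutelyContinuousOnInterval ζ t₀ b)
    (hd : ∀ᵐ t : ℝ, t ∈ Ioo t₀ b → HasDerivAt ζ (S.f (ζ t) (υ t)) t) :
    S.IsTrajectory (J ∪ Ioo t₀ b) υ (fun t => if t ≤ t₀ then ξ t else ζ t) := by
  have hJ := hξ.input.interval
  have hI : IsTimeInterval (J ∪ Ioo t₀ b) := by
    refine ⟨hJ.1.union isOpen_Ioo, ?_, Or.inl hJ.2.2⟩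
    refine ordConnected_of_Ioo fun s hs t ht _ r hr => ?_
    rcases le_or_gt r t₀ with h | h
    · rcases hs with hs | hs
      · exact Or.inl (hJ.2.1.out hs ht₀ ⟨hr.1.le, h⟩)
      · exact absurd (hs.1.trans hr.1) (not_lt.2 h)
    · refine Or.inr ⟨h, hr.2.trans ?_⟩
      rcases ht with ht | ht
      · exact hJb t ht
      · exact ht.2
  refine ⟨hυ.restrict ?_ hI, ?_, ?_⟩
  · refine union_subset hJI fun t ht => hυ.interval.2.1.out (hJI ht₀) hbI ⟨ht.1.le, ht.2.le⟩
  · have key (s : ℝ) (hs : s ∈ J ∪ Ioo t₀ b) :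
        AbsolutelyContinuousOnInterval (fun t => if t ≤ t₀ then ξ t else ζ t) s t₀ := by
      rcases le_or_gt s t₀ with h | h
      · have hsJ : s ∈ J := hs.elim id fun hs => absurd hs.1 (not_lt.2 h)
        refine (hξ.absCont s hsJ t₀ ht₀).congr fun t ht => ?_
        rw [uIcc_of_le h] at ht
        simp [ht.2]
      · have hsb : s ≤ b := (hs.elim (hJb s) fun hs => hs.2).le
        refine ((hac.mono (c := t₀) (d := s) ?_).congr fun t ht => ?_).symm
        · rw [uIcc_of_le h.le, uIcc_of_le htb.le]
          exact Icc_subset_Icc le_rfl hsb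
        · rw [uIcc_of_le h.le] at ht
          rcases ht.1.eq_or_lt with rfl | h'
          · simp [h0]
          · simp [not_le.2 h']
    exact fun s hs t ht => (key s hs).trans (key t ht).symm
  · have hne : ∀ᵐ t : ℝ, t ≠ t₀ := by simp [ae_iff, measure_singleton]
    filter_upwards [hξ.deriv_eq, hd, hne] with t h1 h2 h3 ht
    rcases lt_or_gt_of_ne h3 with h | h
    · have htJ : t ∈ J := ht.elim id fun ht => absurd ht.1 (not_lt.2 h.le)
      simp only [h.le, if_true]
      refine (h1 htJ).congr_of_eventuallyEq ?_
      filter_upwards [Iio_mem_nhds h] with s hs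
      simp [(mem_Iio.1 hs).le]
    · have htb' : t < b := ht.elim (hJb t) fun ht => ht.2
      simp only [not_le.2 h, if_false]
      refine (h2 ⟨h, htb'⟩).congr_of_eventuallyEq ?_
      filter_upwards [Ioi_mem_nhds h] with s hs
      simp [not_le.2 (mem_Ioi.1 hs)]

lemma IsTimeInterval.mem_of_nonneg {I : Set ℝ} (hI : IsTimeInterval I) (hub : ¬ BddAbove I) {t : ℝ}
    (ht : 0 ≤ t) : t ∈ I := by
  obtain ⟨s, hs, hts⟩ := not_bddAbove_iff.1 hub t
  exact hI.Icc_subset hs ⟨ht, hts.le⟩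

/-- On a bounded time interval, the trajectories from a given state can be continued by a uniform
step: they stay in a fixed ball, on which the Picard iteration has a uniform time of existence. -/
lemma exists_uniform_step (hS : S.IsSmooth) (hG : IsRiemannianMetric G)
    (hcomplete : IsCompleteDist (riemannianDist G)) {lam : ℝ} (hlam : 0 < lam)
    (hcon : ContractsStates S G lam) (hb : BoundedOnInputs S) {I : Set ℝ} {υ : ℝ → E m}
    (hυ : IsInput S.U I υ) (hub : ¬ BddAbove I) (x : E n) {T : ℝ} (hT : 0 < T) :
    ∃ h > 0, ∀ (J : Set ℝ) (ξ : ℝ → E n), J ⊆ I → S.IsTrajectory J υ ξ → ξ 0 = x →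
      ∀ t ∈ J, 0 ≤ t → t ≤ T → ∃ (J' : Set ℝ) (ξ' : ℝ → E n), J ⊆ J' ∧ J' ⊆ I ∧
        S.IsTrajectory J' υ ξ' ∧ EqOn ξ ξ' J ∧ t + h ∈ J' := by
  obtain ⟨R, hR⟩ := exists_trajectory_bound hS hG hcomplete hlam hcon hb hυ x hT
  obtain ⟨M, hM, hMb⟩ := hb.exists_velocity_bound hυ (show 0 < T + 1 by linarith) (R + 1)
  obtain ⟨Z, hZ, hZb⟩ := S.lipschitz _ (isCompact_closedBall (0 : E n) (R + 1))
  set k := min 1 (min (1 / M) (1 / (2 * Z))) with hk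
  have hk0 : 0 < k := by positivity
  refine ⟨k / 2, by positivity, fun J ξ hJI hξ h0 t htJ ht0 htT => ?_⟩
  -- half of the Picard step `k` is used, as the continued trajectory lives on an open interval
  by_cases hmem : t + k ∈ J
  · refine ⟨J, ξ, Subset.rfl, hJI, hξ, fun _ _ => rfl, ?_⟩
    exact hξ.input.interval.2.1.out htJ hmem ⟨by linarith, by linarith⟩
  have hball : Metric.closedBall (ξ t) 1 ⊆ Metric.closedBall (0 : E n) (R + 1) := fun y hy => by
    rw [mem_closedBall_iff_norm] at hy
    rw [mem_closedBall_zero_iff]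
    linarith [norm_le_norm_add_norm_sub' y (ξ t), hR J ξ hJI hξ h0 t htJ ht0 htT]
  have hIcc : Icc t (t + k) ⊆ I := fun s hs =>
    hυ.interval.mem_of_nonneg hub (ht0.trans hs.1)
  obtain ⟨ζ, hζ0, hζac, hζd⟩ := exists_local_solution hυ le_rfl (show t ≤ t + k by linarith) hIcc
    (ξ t) hM.le hZ.le (by
      filter_upwards [hMb] with s hs hst y hy
      refine hs (hIcc hst) ?_ y (hball hy)
      rw [abs_of_nonneg (ht0.trans hst.1)]
      linarith [hst.2, min_le_left 1 (min (1 / M) (1 / (2 * Z)))])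
    (fun y hy z hz u hu => hZb y (hball hy) z (hball hz) u hu)
    (by
      have : k ≤ 1 / M := (min_le_right _ _).trans (min_le_left _ _)
      rw [le_div_iff₀ hM] at this
      linarith)
    (by
      have : k ≤ 1 / (2 * Z) := (min_le_right _ _).trans (min_le_right _ _)
      rw [le_div_iff₀ (by positivity)] at this
      linarith)
  have hJb (s : ℝ) (hs : s ∈ J) : s < t + k := by
    by_contra! hle
    exact hmem (hξ.input.interval.2.1.out htJ hs ⟨by linarith, hle⟩)
  have hglue := hξ.glue hυ hJI htJ (show t < t + k by linarith) (hIcc ⟨by linarith, le_rfl⟩) hJb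
    hζ0 hζac hζd
  refine ⟨_, _, subset_union_left, ?_, hglue, fun s hs => ?_, Or.inr ⟨by linarith, by linarith⟩⟩
  · exact union_subset hJI (Ioo_subset_Icc_self.trans hIcc)
  · rcases le_total 0 s with hs0 | hs0
    · exact trajectory_unique hS hG hcomplete hlam hcon hξ hglue (by simp [ht0]) hs0 hs (Or.inl hs)
    · simp [hs0.trans ht0]

lemma exists_extension (hS : S.IsSmooth) (hG : IsRiemannianMetric G)
    (hcomplete : IsCompleteDist (riemannianDist G)) {lam : ℝ} (hlam : 0 < lam)
    (hcon : ContractsStates S G lam) (hb : BoundedOnInputs S) {I : Set ℝ} {υ : ℝ → E m}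
    (hυ : IsInput S.U I υ) (hub : ¬ BddAbove I) {J : Set ℝ} {ξ : ℝ → E n} (hJI : J ⊆ I)
    (hξ : S.IsTrajectory J υ ξ) (T : ℝ) :
    ∃ (J' : Set ℝ) (ξ' : ℝ → E n), J ⊆ J' ∧ J' ⊆ I ∧ S.IsTrajectory J' υ ξ' ∧ EqOn ξ ξ' J ∧
      (0 ≤ T → T ∈ J') := by
  rcases le_or_gt T 0 with hT | hT
  · exact ⟨J, ξ, Subset.rfl, hJI, hξ, fun _ _ => rfl, fun h => by
      rw [le_antisymm hT h]; exact hξ.input.interval.2.2⟩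
  have h0J := hξ.input.interval.2.2
  obtain ⟨h, hh, hstep⟩ := exists_uniform_step hS hG hcomplete hlam hcon hb hυ hub (ξ 0) hT
  have hind (k : ℕ) : ∃ (J' : Set ℝ) (ξ' : ℝ → E n), J ⊆ J' ∧ J' ⊆ I ∧ S.IsTrajectory J' υ ξ' ∧
      EqOn ξ ξ' J ∧ min T (k * h) ∈ J' := by
    induction k with
    | zero => exact ⟨J, ξ, Subset.rfl, hJI, hξ, fun _ _ => rfl, by simpa [hT.le] using h0J⟩
    | succ k ih =>
      obtain ⟨J₁, ξ₁, hJJ₁, hJ₁I, hξ₁, heq₁, hmem₁⟩ := ih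
      have hnn : 0 ≤ min T (k * h) := by positivity
      obtain ⟨J₂, ξ₂, hJ₁₂, hJ₂I, hξ₂, heq₂, hmem₂⟩ := hstep J₁ ξ₁ hJ₁I hξ₁ (heq₁ h0J).symm _
        hmem₁ hnn (min_le_left _ _)
      refine ⟨J₂, ξ₂, hJJ₁.trans hJ₁₂, hJ₂I, hξ₂,
        fun t ht => (heq₁ ht).trans (heq₂ (hJJ₁ ht)), ?_⟩
      refine hξ₂.input.interval.Icc_subset hmem₂ ⟨by positivity, ?_⟩
      rw [← min_add_add_right]
      push_cast
      exact min_le_min (by linarith) (by linarith)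
  obtain ⟨k, hk⟩ := exists_nat_gt (T / h)
  obtain ⟨J', ξ', h1, h2, h3, h4, h5⟩ := hind k
  rw [div_lt_iff₀ hh] at hk
  rw [min_eq_left hk.le] at h5
  exact ⟨J', ξ', h1, h2, h3, h4, fun _ => h5⟩

/-- Every trajectory extends to all nonnegative times; by uniqueness its continuations up to the
times `0, 1, 2, …` fit together. -/
lemma exists_global_extension (hS : S.IsSmooth) (hG : IsRiemannianMetric G)
    (hcomplete : IsCompleteDist (riemannianDist G)) {lam : ℝ} (hlam : 0 < lam)
    (hcon : ContractsStates S G lam) (hb : BoundedOnInputs S) {I : Set ℝ} {υ : ℝ → E m}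
    (hυ : IsInput S.U I υ) (hub : ¬ BddAbove I) {J : Set ℝ} {ξ : ℝ → E n} (hJI : J ⊆ I)
    (hξ : S.IsTrajectory J υ ξ) :
    ∃ (J' : Set ℝ) (ξ' : ℝ → E n),
      J ⊆ J' ∧ J' ⊆ I ∧ ¬ BddAbove J' ∧ S.IsTrajectory J' υ ξ' ∧ EqOn ξ ξ' J := by
  have hJ := hξ.input.interval
  choose! Jn ξn hJJ hJnI htraj heq hTn using fun N : ℕ =>
    exists_extension hS hG hcomplete hlam hcon hb hυ hub hJI hξ N
  replace hTn (N : ℕ) : (N : ℝ) ∈ Jn N := hTn N N.cast_nonneg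
  set ζ : ℝ → E n := fun t => ξn ⌈t⌉₊ t with hζ
  have hζJ (t : ℝ) (ht : t ∈ J) : ξ t = ζ t := heq _ ht
  have hin (N : ℕ) (t : ℝ) (ht : t ∈ J ∪ Ici 0) (htN : t ≤ N) : t ∈ Jn N := by
    rcases ht with ht | ht
    · exact hJJ N ht
    · exact (htraj N).input.interval.Icc_subset (hTn N) ⟨ht, htN⟩
  have hζN (N : ℕ) (t : ℝ) (ht : t ∈ J ∪ Ici 0) (htN : t ≤ N) : ζ t = ξn N t := by
    rcases le_total 0 t with h0 | h0
    · refine trajectory_unique hS hG hcomplete hlam hcon (htraj _) (htraj N) ?_ h0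
        (hin _ t ht (Nat.le_ceil t)) (hin N t ht htN)
      rw [← heq _ hJ.2.2, ← heq _ hJ.2.2]
    · have htJ : t ∈ J := by
        rcases ht with ht | ht
        · exact ht
        · rw [le_antisymm h0 ht]; exact hJ.2.2
      rw [← hζJ t htJ, heq N htJ]
  have hopen : IsOpen (J ∪ Ici 0) := by
    have : J ∪ Ici 0 = J ∪ Ioi 0 := by
      ext t
      refine ⟨fun ht => ht.elim Or.inl fun h => ?_, fun ht =>
        ht.elim Or.inl fun h => Or.inr (le_of_lt (mem_Ioi.1 h))⟩
      rcases (mem_Ici.1 h).eq_or_lt with rfl | h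
      · exact Or.inl hJ.2.2
      · exact Or.inr h
    rw [this]
    exact hJ.1.union isOpen_Ioi
  have hint : IsTimeInterval (J ∪ Ici 0) := by
    refine ⟨hopen, ordConnected_of_Ioo fun s hs t ht _ r hr => ?_, Or.inl hJ.2.2⟩
    rcases le_total 0 r with h | h
    · exact Or.inr h
    · rcases hs with hs | hs
      · exact Or.inl (hJ.2.1.out hs hJ.2.2 ⟨hr.1.le, h⟩)
      · exact Or.inr ((mem_Ici.1 hs).trans hr.1.le)
  have hsub : J ∪ Ici 0 ⊆ I := union_subset hJI fun t ht => hυ.interval.mem_of_nonneg hub ht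
  refine ⟨J ∪ Ici 0, ζ, subset_union_left, hsub, ?_, ⟨hυ.restrict hsub hint, ?_, ?_⟩, hζJ⟩
  · exact fun h => not_bddAbove_Ici (a := (0 : ℝ)) (h.mono subset_union_right)
  · intro s hs t ht
    obtain ⟨N, hN⟩ := exists_nat_ge (max s t)
    have hsN := (le_max_left s t).trans hN
    have htN := (le_max_right s t).trans hN
    refine ((htraj N).absCont s (hin N s hs hsN) t (hin N t ht htN)).congr fun r hr => ?_
    exact (hζN N r (hint.2.1.uIcc_subset hs ht hr) (hr.2.trans hN)).symm
  · filter_upwards [ae_all_iff.2 fun N => (htraj N).deriv_eq] with t hd ht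
    obtain ⟨N, hN⟩ := exists_nat_gt t
    have := hd N (hin N t ht hN.le)
    rw [← hζN N t ht hN.le] at this
    refine this.congr_of_eventuallyEq ?_
    filter_upwards [hopen.mem_nhds ht, Iio_mem_nhds hN] with s hs hsN
    exact hζN N s hs (le_of_lt hsN)

theorem forwardComplete_of_contractsStates (hS : S.IsSmooth) (hG : IsRiemannianMetric G)
    (hcomplete : IsCompleteDist (riemannianDist G)) {lam : ℝ} (hlam : 0 < lam)
    (hcon : ContractsStates S G lam) (hb : BoundedOnInputs S) : S.ForwardComplete := by
  intro I υ hυ hub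
  refine ⟨fun x => ?_, fun J ξ hJI hξ =>
    exists_global_extension hS hG hcomplete hlam hcon hb hυ hub hJI hξ⟩
  obtain ⟨δ, hδ, hδI⟩ := Metric.isOpen_iff.1 hυ.interval.1 0 hυ.interval.2.2
  obtain ⟨M, hM, hMb⟩ := hb.exists_velocity_bound hυ one_pos (‖x‖ + 1)
  obtain ⟨Z, hZ, hZb⟩ := S.lipschitz _ (isCompact_closedBall (0 : E n) (‖x‖ + 1))
  set k := min (min 1 (δ / 2)) (min (1 / (2 * M)) (1 / (4 * Z))) with hk
  have hk0 : 0 < k := by positivity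
  have hk1 : k ≤ 1 := (min_le_left _ _).trans (min_le_left _ _)
  have hkδ : k ≤ δ / 2 := (min_le_left _ _).trans (min_le_right _ _)
  have hball : Metric.closedBall x 1 ⊆ Metric.closedBall (0 : E n) (‖x‖ + 1) := fun y hy => by
    rw [mem_closedBall_iff_norm] at hy
    rw [mem_closedBall_zero_iff]
    linarith [norm_le_norm_add_norm_sub' y x]
  have hIcc : Icc (-k) k ⊆ I := fun s hs => hδI (by
    rw [Metric.mem_ball, dist_zero_right, Real.norm_eq_abs]
    linarith [abs_le.2 hs])
  obtain ⟨ξ, h0, hac, hd⟩ := exists_local_solution hυ (show -k ≤ 0 by linarith) hk0.le hIcc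
    x hM.le hZ.le (by
      filter_upwards [hMb] with s hs hst y hy
      exact hs (hIcc hst) ((abs_le.2 hst).trans hk1) y (hball hy))
    (fun y hy z hz u hu => hZb y (hball hy) z (hball hz) u hu)
    (by
      have : k ≤ 1 / (2 * M) := (min_le_right _ _).trans (min_le_left _ _)
      rw [le_div_iff₀ (by positivity)] at this
      linarith)
    (by
      have : k ≤ 1 / (4 * Z) := (min_le_right _ _).trans (min_le_right _ _)
      rw [le_div_iff₀ (by positivity)] at this
      linarith)
  have hJI : Ioo (-k) k ⊆ I := Ioo_subset_Icc_self.trans hIcc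
  have hJ : IsTimeInterval (Ioo (-k) k) := ⟨isOpen_Ioo, ordConnected_Ioo, by linarith, hk0⟩
  have hξ : S.IsTrajectory (Ioo (-k) k) υ ξ := by
    refine ⟨hυ.restrict hJI hJ, fun s hs t ht => hac.mono ?_, hd⟩
    rw [uIcc_of_le (show -k ≤ k by linarith)]
    exact uIcc_subset_Icc (Ioo_subset_Icc_self hs) (Ioo_subset_Icc_self ht)
  obtain ⟨J', ξ', hJJ', hJ'I, hub', hξ', heq⟩ :=
    exists_global_extension hS hG hcomplete hlam hcon hb hυ hub hJI hξ
  exact ⟨J', ξ', hJ'I, hub', hξ', by rw [← heq hJ.2.2, h0]⟩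

/-! ### Comparison functions -/

lemma isClassKL_exp_mul {k : ℝ} (hk : 0 < k) :
    IsClassKL fun r s : ℝ≥0 => Real.toNNReal (Real.exp (-k * s)) * r where
  continuous := by fun_prop
  classKInf s := by
    have hpos : 0 < Real.toNNReal (Real.exp (-k * s)) := Real.toNNReal_pos.2 (Real.exp_pos _)
    exact ⟨by fun_prop, fun a b hab => by simpa using mul_lt_mul_of_pos_left hab hpos, mul_zero _,
      tendsto_id.const_mul_atTop hpos⟩
  strictAnti r hr s t hst := by
    refine mul_lt_mul_of_pos_right ?_ (pos_iff_ne_zero.2 hr)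
    rw [Real.toNNReal_lt_toNNReal_iff (Real.exp_pos _), Real.exp_lt_exp]
    have : (s : ℝ) < t := hst
    nlinarith
  tendsto r hr := by
    have h1 : Tendsto (fun s : ℝ≥0 => Real.exp (-k * s)) atTop (𝓝 0) := by
      refine Real.tendsto_exp_atBot.comp ?_
      exact (NNReal.tendsto_coe_atTop.2 tendsto_id).const_mul_atTop_of_neg (by linarith)
    have h2 := ((continuous_real_toNNReal.tendsto 0).comp h1).mul_const r
    simpa using h2

lemma isClassKInf_const_mul {c : ℝ≥0} (hc : 0 < c) : IsClassKInf fun r => c * r :=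
  ⟨by fun_prop, fun a b hab => by simpa using mul_lt_mul_of_pos_left hab hc, mul_zero _,
    tendsto_id.const_mul_atTop hc⟩

theorem isDeltaGAS_of_contractsStates (hS : S.IsSmooth) (hG : IsRiemannianMetric G)
    (hcomplete : IsCompleteDist (riemannianDist G)) {lam : ℝ} (hlam : 0 < lam)
    (hcon : ContractsStates S G lam) (hb : BoundedOnInputs S) : S.IsDeltaGAS := by
  refine ⟨forwardComplete_of_contractsStates hS hG hcomplete hlam hcon hb, riemannianDist G, _,
    hG.isMetric, isClassKL_exp_mul (half_pos hlam), fun I I' υ ξ ξ' hξ hξ' t ht ht' => ?_⟩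
  have := dist_le_of_contractsStates hS hG hcomplete hlam hcon hξ hξ' t.coe_nonneg ht ht'
  rw [← NNReal.coe_le_coe, NNReal.coe_mul, Real.coe_toNNReal _ (Real.exp_pos _).le]
  exact this

theorem isDeltaISS_of_contractsStatesInputs (hS : S.IsSmooth) (hU : Convex ℝ S.U)
    (hG : IsRiemannianMetric G) (hcomplete : IsCompleteDist (riemannianDist G)) {lam α : ℝ}
    (hlam : 0 < lam) (hα : 0 ≤ α) (hcon : ContractsStatesInputs S G lam α) : S.IsDeltaISS := by
  -- the gain is `α / lam + 1`, since a function of class `𝒦_∞` is needed also if `α = 0`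
  refine ⟨forwardComplete_of_contractsStates hS hG hcomplete hlam hcon.contractsStates
      (hcon.boundedOnInputs hS hU hG hα),
    riemannianDist G, _, _, hG.isMetric, isClassKL_exp_mul (half_pos hlam),
    isClassKInf_const_mul (c := Real.toNNReal (α / lam) + 1) (by positivity),
    fun I I' υ υ' ξ ξ' hξ hξ' hfin t ht ht' => ?_⟩
  have := dist_le_of_contractsStatesInputs hS hU hG hcomplete hlam hα hcon hξ hξ' hfin
    t.coe_nonneg ht ht'
  rw [← NNReal.coe_le_coe]
  push_cast
  rw [Real.coe_toNNReal _ (Real.exp_pos _).le, Real.coe_toNNReal _ (by positivity)]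
  refine this.trans ?_
  rw [add_mul, one_mul]
  have h0 : 0 ≤ (inputDist I I' υ υ').toReal := ENNReal.toReal_nonneg
  change _ ≤ _ + (_ + (inputDist I I' υ υ').toReal)
  linarith

end IncrementalStability

end

open IncrementalStability in
theorem mainTheorem5 {n m : ℕ} (S : ControlSystem n m) (hS : S.IsSmooth)
    (hU : Convex ℝ S.U)
    (G : E n → Matrix (Fin n) (Fin n) ℝ) (hG : IsRiemannianMetric G)
    (hcomplete : IsCompleteDist (riemannianDist G)) :
    -- contraction with respect to states and inputs
    (IsContractionMetricStatesInputs S G → S.IsDeltaISS) ∧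
    (∀ lam α : ℝ, 0 < lam → 0 ≤ α → ContractsStatesInputs S G lam α →
      ∀ (I I' : Set ℝ) (υ υ' : ℝ → E m) (ξ ξ' : ℝ → E n),
        S.IsTrajectory I υ ξ → S.IsTrajectory I' υ' ξ' → inputDist I I' υ υ' ≠ ⊤ →
        ∀ t : ℝ, 0 ≤ t → t ∈ I → t ∈ I' →
          (riemannianDist G (ξ t) (ξ' t) : ℝ) ≤
            Real.exp (-(lam / 2) * t) * riemannianDist G (ξ 0) (ξ' 0) +
              α / lam * (inputDist I I' υ υ').toReal) ∧
    -- contraction with respect to states only; the first hypothesis holds when `S.U` is closed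
    ((∀ (x : E n) (r : ℝ), ∃ C : ℝ, ∀ u ∈ S.U, ‖u‖ ≤ r → ‖S.f x u‖ ≤ C) →
      IsContractionMetricStates S G → S.IsDeltaGAS) ∧
    (∀ lam : ℝ, 0 < lam → ContractsStates S G lam →
      ∀ (I I' : Set ℝ) (υ : ℝ → E m) (ξ ξ' : ℝ → E n),
        S.IsTrajectory I υ ξ → S.IsTrajectory I' υ ξ' →
        ∀ t : ℝ, 0 ≤ t → t ∈ I → t ∈ I' →
          (riemannianDist G (ξ t) (ξ' t) : ℝ) ≤
            Real.exp (-(lam / 2) * t) * riemannianDist G (ξ 0) (ξ' 0)) := by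
  refine ⟨?_, ?_, ?_, ?_⟩
  · rintro ⟨lam, α, hlam, hα, hcon⟩
    exact isDeltaISS_of_contractsStatesInputs hS hU hG hcomplete hlam hα hcon
  · intro lam α hlam hα hcon I I' υ υ' ξ ξ' hξ hξ' hfin t ht htI htI'
    exact dist_le_of_contractsStatesInputs hS hU hG hcomplete hlam hα hcon hξ hξ' hfin ht htI htI'
  · rintro hb ⟨lam, hlam, hcon⟩
    exact isDeltaGAS_of_contractsStates hS hG hcomplete hlam hcon hb
  · intro lam hlam hcon I I' υ ξ ξ' hξ hξ' t ht htI htI'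
    exact dist_le_of_contractsStates hS hG hcomplete hlam hcon hξ hξ' ht htI htI'
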